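/- Let $\mathcal G$ be a non-compact connected metric graph with finitely many vertices and edges; each edge is identified with a compact interval $[0,|e|]$, $|e|>0$, or with a closed half-line $[0,+\infty)$ (self-loops, multiple edges and vertices of degree $2$ are allowed). Points at infinity do not belong to the metric graph. Let $H^1(\mathcal G)$ be the space of (real- or complex-valued) continuous functions on $\mathcal G$ whose restriction to every edge $e$ is in $H^1(e)$. For $u\in H^1(\mathcal G)$ and $\mu>0$ put $$E(u,\mathcal G)=\frac12\int_{\mathcal G}|u'|^2-\frac16\int_{\mathcal G}|u|^6,\qquad H^1_\mu(\mathcal G)=\Big\{u\in H^1(\mathcal G):\int_{\mathcal G}|u|^2=\mu\Big\},\qquad \mathcal E_{\mathcal G}(\mu)=\inf_{u\in H^1_\mu(\mathcal G)}E(u,\mathcal G).$$ The critical mass of a non-compact connected metric graph $\mathcal G$ is $\mu_{\mathcal G}=\sqrt{3/K_{\mathcal G}}$, where $K_{\mathcal G}$ is the best constant in the Gagliardo--Nirenberg inequality $\|u\|_{L^6(\mathcal G)}^6\le K_{\mathcal G}\|u\|_{L^2(\mathcal G)}^4\|u'\|_{L^2(\mathcal G)}^2$, $u\in H^1(\mathcal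 G)$. For an unbounded edge (an open half-line) $\ell$ of $\mathcal G$, let $\mathcal G\setminus\ell$ be the graph obtained by removing the edge $\ell$ and its vertex at infinity, keeping the vertex from which $\ell$ emanates. Assume that $\mathcal G$, with its path metric, is not isometric to $\mathbb R^+=[0,+\infty)$, and that $\mathcal E_{\mathcal G}(\mu_{\mathcal G})$ is achieved, i.e. there is $u\in H^1_{\mu_{\mathcal G}}(\mathcal G)$ with $E(u,\mathcal G)=\mathcal E_{\mathcal G}(\mu_{\mathcal G})$. Then there exists an open half-line $\ell\subset\mathcal G$ such that $\mathcal G\setminus\ell$ is still non-compact and $\mu_{\mathcal G\setminus\ell}<\mu_{\mathcal G}$. -/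

import Mathlib

open MeasureTheory Set
open scoped ENNReal NNReal

/-- The data of a metric graph with vertex set `V`, set of bounded edges `B` and set of unbounded
edges (half-lines) `H`. Self-loops and multiple edges are allowed. The bounded edge `b` is
identified with `[0, len b]`, the point `0` being glued to the vertex `src b` and the point `len b`
to the vertex `tgt b`; the half-line `h` is identified with `[0, ∞)`, the point `0` being glued to
the vertex `root h`. The points at infinity of the half-lines do not belong to the metric graph and
are not elements of `V`. -/
structure MetricGraph (V B H : Type*) where
  /-- initial vertex of a bounded edge -/
  src : B → V
  /-- final vertex of a bounded edge -/
  tgt : B → V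
  /-- length of a bounded edge -/
  len : B → ℝ
  len_pos : ∀ b, 0 < len b
  /-- the (finite) vertex from which a half-line emanates -/
  root : H → V

namespace MetricGraph

variable {V B H : Type*}

/-- The interval with which an edge is identified. -/
def interval (G : MetricGraph V B H) : B ⊕ H → Set ℝ
  | .inl b => Icc 0 (G.len b)
  | .inr _ => Ici 0

/-- `G.AtVertex e x v`: the coordinate `x` on the edge `e` is an endpoint of `e` that is glued to
the vertex `v`. -/
inductive AtVertex (G : MetricGraph V B H) : B ⊕ H → ℝ → V → Prop
  | src (b : B) : AtVertex G (.inl b) 0 (G.src b)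
  | tgt (b : B) : AtVertex G (.inl b) (G.len b) (G.tgt b)
  | root (h : H) : AtVertex G (.inr h) 0 (G.root h)

/-- The graph is connected: any two vertices are joined by a chain of bounded edges (a half-line
has only one vertex at finite distance). -/
def IsConnected (G : MetricGraph V B H) : Prop :=
  (SimpleGraph.fromRel fun v w : V => ∃ b : B, G.src b = v ∧ G.tgt b = w).Connected

/-- A metric graph with finitely many edges is non-compact iff it has an unbounded edge. -/
def IsNoncompact (_ : MetricGraph V B H) : Prop := Nonempty H

/-- The graph `G ∖ ℓ`: the open half-line `ℓ` (and its point at infinity) is removed, the vertex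
from which it emanates is kept. -/
def removeHalfLine (G : MetricGraph V B H) (l : H) : MetricGraph V B {h : H // h ≠ l} where
  src := G.src
  tgt := G.tgt
  len := G.len
  len_pos := G.len_pos
  root h := G.root h

/-! ### The metric -/

/-- Points of the graph, given by an edge and a coordinate on it. Coordinates that are glued to
the same vertex are at distance `0` for `MetricGraph.dist`. -/
structure Point (G : MetricGraph V B H) where
  /-- an edge containing the point -/
  edge : B ⊕ H
  /-- the coordinate of the point on that edge -/
  coord : ℝ
  mem : coord ∈ G.interval edge

/-- `G.IsRoute p q L`: there is a path from `p` to `q` of total length `L`, which is a finite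
concatenation of segments contained in edges. -/
inductive IsRoute (G : MetricGraph V B H) : G.Point → G.Point → ℝ → Prop
  | along (p q : G.Point) : p.edge = q.edge → IsRoute G p q |p.coord - q.coord|
  | glue (p q : G.Point) (v : V) :
      G.AtVertex p.edge p.coord v → G.AtVertex q.edge q.coord v → IsRoute G p q 0
  | trans (p q r : G.Point) (L M : ℝ) :
      IsRoute G p q L → IsRoute G q r M → IsRoute G p r (L + M)

/-- The path distance on the graph: the infimum of the lengths of the paths joining two points. -/
noncomputable def dist (G : MetricGraph V B H) (p q : G.Point) : ℝ≥0∞ :=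
  ⨅ (L : ℝ) (_ : G.IsRoute p q L), ENNReal.ofReal L

/-- The graph, with its path distance, is isometric to `ℝ⁺ = [0, ∞)`. -/
def IsometricToHalfLine (G : MetricGraph V B H) : Prop :=
  ∃ f : G.Point → ℝ≥0, Function.Surjective f ∧ ∀ p q, edist (f p) (f q) = G.dist p q

/-! ### Sobolev functions

A function on the graph is a family `u e : ℝ → 𝕜`, `e : B ⊕ H`, of functions of the edge
coordinates; only the values `u e x` for `x ∈ G.interval e` matter. -/

variable {𝕜 : Type*} [RCLike 𝕜]

/-- `f ∈ H¹(I)` for an interval `I`: `f` is (locally) absolutely continuous on `I`, and `f` and its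
almost everywhere defined derivative are square integrable on `I`. -/
def MemH1Interval (I : Set ℝ) (f : ℝ → 𝕜) : Prop :=
  (∀ a ∈ I, ∀ b ∈ I, AbsolutelyContinuousOnInterval f a b) ∧
    MemLp f 2 (volume.restrict I) ∧ MemLp (deriv f) 2 (volume.restrict I)

/-- `u ∈ H¹(G)`: `u` is continuous on the graph (it is continuous on every edge and has a
well-defined value at every vertex) and its restriction to every edge is an `H¹` function. -/
def MemH1 (G : MetricGraph V B H) (u : B ⊕ H → ℝ → 𝕜) : Prop :=
  (∀ e, MemH1Interval (G.interval e) (u e)) ∧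
    ∃ φ : V → 𝕜, ∀ e x v, G.AtVertex e x v → u e x = φ v

section Energy

variable [Fintype B] [Fintype H]

/-- `∫_G |u|^p`. -/
noncomputable def integralPow (G : MetricGraph V B H) (p : ℕ) (u : B ⊕ H → ℝ → 𝕜) : ℝ :=
  ∑ e, ∫ x in G.interval e, ‖u e x‖ ^ p

/-- `∫_G |u'|^2`. -/
noncomputable def kinetic (G : MetricGraph V B H) (u : B ⊕ H → ℝ → 𝕜) : ℝ :=
  ∑ e, ∫ x in G.interval e, ‖deriv (u e) x‖ ^ 2

/-- The energy `E(u, G) = (1/2) ∫_G |u'|^2 - (1/6) ∫_G |u|^6`. -/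
noncomputable def energy (G : MetricGraph V B H) (u : B ⊕ H → ℝ → 𝕜) : ℝ :=
  (1 / 2) * G.kinetic u - (1 / 6) * G.integralPow 6 u

variable (𝕜)

/-- `H¹_μ(G)`: the functions in `H¹(G)` of mass `μ`. -/
def H1Mass (G : MetricGraph V B H) (μ : ℝ) : Set (B ⊕ H → ℝ → 𝕜) :=
  {u | G.MemH1 u ∧ G.integralPow 2 u = μ}

/-- The ground state energy level: the infimum of `E(u, G)` over `u ∈ H¹_μ(G)`,
possibly `-∞`. -/
noncomputable def groundStateLevel (G : MetricGraph V B H) (μ : ℝ) : EReal :=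
  ⨅ u ∈ G.H1Mass 𝕜 μ, (G.energy u : EReal)

/-- The ground state energy level is achieved. -/
def GroundStateAchieved (G : MetricGraph V B H) (μ : ℝ) : Prop :=
  ∃ u ∈ G.H1Mass 𝕜 μ, (G.energy u : EReal) = G.groundStateLevel 𝕜 μ

/-- The best constant `K` in the Gagliardo-Nirenberg inequality
`‖u‖₆⁶ ≤ K ‖u‖₂⁴ ‖u'‖₂²`, `u ∈ H¹(G)`. -/
noncomputable def gagliardoNirenbergConst (G : MetricGraph V B H) : ℝ :=
  sInf {K : ℝ | 0 ≤ K ∧ ∀ u : B ⊕ H → ℝ → 𝕜, G.MemH1 u →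
    G.integralPow 6 u ≤ K * G.integralPow 2 u ^ 2 * G.kinetic u}

/-- The critical mass `μ_G` of a non-compact graph: `3 / μ_G ^ 2` is the best constant in the
Gagliardo-Nirenberg inequality. -/
noncomputable def criticalMass (G : MetricGraph V B H) : ℝ :=
  √(3 / G.gagliardoNirenbergConst 𝕜)

end Energy

end MetricGraph

/-! Passing to the modulus does not increase the kinetic energy, so real functions suffice.
Spreading a function along a half-line shows that the ground state level is at most zero at every
positive mass, while the Gagliardo-Nirenberg (GN) inequality makes the energy nonnegative at the
critical mass. A ground state `u` at the critical mass thus has energy zero and is extremal for GN.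
Extremals vanish nowhere (`MemH1.ne_zero_of_extremal`): near a zero, replacing `u` by `√(u ^ 2 + ψ ^
2)` with a small `ψ > 0` saves kinetic energy at an arbitrarily large rate compared with the mass it
adds.

Let `m = √3 π / 4` (`halfLineMass`), the critical mass of the half-line; that of the line is `2m`.
Suppose that there are at least two half-lines. One on which `u` has negative energy carries mass
larger than `m`, and soliton test functions give `μ_G ≤ 2m`, so `u` has nonnegative energy on some
half-line `l`. Its restriction to `G ∖ l` has nonpositive energy and, since `u ≠ 0` on `l`, mass
smaller than `μ_G`. GN on `G ∖ l` then bounds the critical mass of `G ∖ l` by that smaller mass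
(`MemH1.criticalMass_removeHalfLine_lt`).

With a single half-line `μ_G = m`, and the equality case is settled by a calibration. If `u ^ 2 ≤
N`, the inequality between arithmetic and geometric means gives `3 u'^2 - u^6 + N^2 u^2 ≥ √3
|(F_N(u^2))'|`, where `F_N(0) = 0` and `F_N'(s) = √(N^2 - s^2)`. Let `S` be the maximum of `u ^ 2`.
Integrating with `N = S` from a maximum point along a simple path to infinity
(`MemH1.exists_escape`) yields `S^2 m ≤ 6 E(u) + S^2 ∫ u^2`, hence GN with the constant of the
half-line. If the energy is zero and the mass is `m`, taking `N` slightly above `S` shows that no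
mass lies off the path. Since `u` vanishes nowhere, the path is the whole graph, which is then
isometric to `[0, ∞)` (`MemH1.isometricToHalfLine`); this is excluded. -/

/-! ### Absolutely continuous functions -/

/-- The composition of a Lipschitz function with an absolutely continuous function is absolutely
continuous. -/
theorem AbsolutelyContinuousOnInterval.lipschitz_comp {X Y : Type*} [PseudoMetricSpace X]
    [PseudoMetricSpace Y] {f : ℝ → X} {a b : ℝ} (hf : AbsolutelyContinuousOnInterval f a b)
    {g : X → Y} {C : ℝ}
    (hg : ∀ x ∈ uIcc a b, ∀ y ∈ uIcc a b, dist (g (f x)) (g (f y)) ≤ C * dist (f x) (f y)) :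
    AbsolutelyContinuousOnInterval (fun x => g (f x)) a b := by
  rw [absolutelyContinuousOnInterval_iff] at hf ⊢
  intro ε hε
  obtain ⟨δ, hδ, h⟩ := hf (ε / (|C| + 1)) (by positivity)
  refine ⟨δ, hδ, fun E hE hlt => ?_⟩
  calc ∑ i ∈ Finset.range E.1, dist (g (f (E.2 i).1)) (g (f (E.2 i).2))
      ≤ ∑ i ∈ Finset.range E.1, (|C| + 1) * dist (f (E.2 i).1) (f (E.2 i).2) := by
        refine Finset.sum_le_sum fun i hi => (hg _ (hE.1 i hi).1 _ (hE.1 i hi).2).trans ?_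
        gcongr
        linarith [le_abs_self C]
    _ = (|C| + 1) * ∑ i ∈ Finset.range E.1, dist (f (E.2 i).1) (f (E.2 i).2) := by
        rw [Finset.mul_sum]
    _ < (|C| + 1) * (ε / (|C| + 1)) := by
        gcongr
        exact h E hE hlt
    _ = ε := by field_simp

theorem AbsolutelyContinuousOnInterval.norm {F : Type*} [SeminormedAddCommGroup F] {f : ℝ → F}
    {a b : ℝ} (hf : AbsolutelyContinuousOnInterval f a b) :
    AbsolutelyContinuousOnInterval (fun x => ‖f x‖) a b :=
  hf.lipschitz_comp (X := F) (Y := ℝ) (g := fun z : F => ‖z‖) (C := 1) fun x _ y _ => by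
    rw [one_mul, dist_eq_norm (f x)]
    exact dist_norm_norm_le (f x) (f y)

/-- A `C¹` function is Lipschitz on a compact interval. Smoothness is required only on an interval
containing the values of `f`, so that the square root away from `0` is allowed. -/
theorem AbsolutelyContinuousOnInterval.contDiff_comp {f : ℝ → ℝ} {a b : ℝ}
    (hf : AbsolutelyContinuousOnInterval f a b) {g : ℝ → ℝ} {c d : ℝ}
    (hg : ContDiffOn ℝ 1 g (Icc c d)) (hm : ∀ x ∈ uIcc a b, f x ∈ Icc c d) :
    AbsolutelyContinuousOnInterval (fun x => g (f x)) a b := by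
  obtain ⟨K, hK⟩ := hg.exists_lipschitzOnWith (by decide) (convex_Icc _ _) isCompact_Icc
  exact hf.lipschitz_comp (C := K) fun x hx y hy => hK.dist_le_mul _ (hm x hx) _ (hm y hy)

theorem AbsolutelyContinuousOnInterval.ae_differentiableAt_of_finiteDimensional {F : Type*}
    [NormedAddCommGroup F] [NormedSpace ℝ F] [FiniteDimensional ℝ F] {f : ℝ → F} {a b : ℝ}
    (hf : AbsolutelyContinuousOnInterval f a b) :
    ∀ᵐ x : ℝ, x ∈ uIcc a b → DifferentiableAt ℝ f x :=
  hf.boundedVariationOn.ae_differentiableAt_of_mem_uIcc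

/-- By the reverse triangle inequality the difference quotients of the norm are dominated by those
of `f`. -/
theorem abs_deriv_norm_le {F : Type*} [NormedAddCommGroup F] [NormedSpace ℝ F] {f : ℝ → F} {x : ℝ}
    (hf : DifferentiableAt ℝ f x) (hn : DifferentiableAt ℝ (fun y => ‖f y‖) x) :
    |deriv (fun y => ‖f y‖) x| ≤ ‖deriv f x‖ := by
  have h1 := (hasDerivAt_iff_tendsto_slope.1 hn.hasDerivAt).norm
  have h2 := (hasDerivAt_iff_tendsto_slope.1 hf.hasDerivAt).norm
  refine le_of_tendsto_of_tendsto' h1 h2 fun y => ?_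
  simp only [slope_def_module, norm_smul]
  gcongr
  simpa using abs_norm_sub_norm_le (f y) (f x)

/-! ### Sobolev functions on an edge -/

namespace MetricGraph

/-- `I` is one of the intervals with which the edges of a metric graph are identified. -/
def IsEdgeInterval (I : Set ℝ) : Prop := (∃ L : ℝ, 0 < L ∧ I = Icc 0 L) ∨ I = Ici 0

theorem isEdgeInterval_interval {V B H : Type*} (G : MetricGraph V B H) (e : B ⊕ H) :
    IsEdgeInterval (G.interval e) := by
  cases e with
  | inl b => exact Or.inl ⟨G.len b, G.len_pos b, rfl⟩
  | inr h => exact Or.inr rfl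

namespace IsEdgeInterval

variable {I : Set ℝ}

theorem measurableSet (hI : IsEdgeInterval I) : MeasurableSet I := by
  rcases hI with ⟨L, -, rfl⟩ | rfl
  · exact measurableSet_Icc
  · exact measurableSet_Ici

theorem ordConnected (hI : IsEdgeInterval I) : I.OrdConnected := by
  rcases hI with ⟨L, -, rfl⟩ | rfl
  · exact ordConnected_Icc
  · exact ordConnected_Ici

theorem zero_mem (hI : IsEdgeInterval I) : (0 : ℝ) ∈ I := by
  rcases hI with ⟨L, hL, rfl⟩ | rfl
  · exact ⟨le_rfl, hL.le⟩
  · exact self_mem_Ici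

/-- The half-line is the countable union of the intervals `[0, n]`, so almost everywhere statements
on compact intervals suffice. -/
theorem ae_restrict_of_forall (hI : IsEdgeInterval I) {P : ℝ → Prop}
    (h : ∀ a ∈ I, ∀ b ∈ I, ∀ᵐ x : ℝ, x ∈ uIcc a b → P x) : ∀ᵐ x ∂volume.restrict I, P x := by
  rw [ae_restrict_iff' hI.measurableSet]
  rcases hI with ⟨L, hL, rfl⟩ | rfl
  · filter_upwards [h 0 ⟨le_rfl, hL.le⟩ L ⟨hL.le, le_rfl⟩] with x hx hxI
    exact hx (by rwa [uIcc_of_le hL.le])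
  · have := ae_all_iff.2 fun n : ℕ => h 0 self_mem_Ici n (mem_Ici.2 n.cast_nonneg)
    filter_upwards [this] with x hx hxI
    obtain ⟨n, hn⟩ := exists_nat_ge x
    exact hx n (by rw [uIcc_of_le (Nat.cast_nonneg n)]; exact ⟨hxI, hn⟩)

end IsEdgeInterval

namespace MemH1Interval

variable {𝕜 : Type*} [RCLike 𝕜] {I : Set ℝ} {u : ℝ → 𝕜}

theorem ae_differentiableAt (hu : MemH1Interval I u) (hI : IsEdgeInterval I) :
    ∀ᵐ x ∂volume.restrict I, DifferentiableAt ℝ u x :=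
  hI.ae_restrict_of_forall fun a ha b hb =>
    (hu.1 a ha b hb).ae_differentiableAt_of_finiteDimensional

theorem ae_abs_deriv_norm_le (hu : MemH1Interval I u) (hI : IsEdgeInterval I) :
    ∀ᵐ x ∂volume.restrict I, |deriv (fun y => ‖u y‖) x| ≤ ‖deriv u x‖ := by
  have h : ∀ᵐ x ∂volume.restrict I, DifferentiableAt ℝ (fun y => ‖u y‖) x :=
    hI.ae_restrict_of_forall fun a ha b hb => (hu.1 a ha b hb).norm.ae_differentiableAt
  filter_upwards [h, hu.ae_differentiableAt hI] with x h1 h2 using abs_deriv_norm_le h2 h1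

theorem norm (hu : MemH1Interval I u) (hI : IsEdgeInterval I) :
    MemH1Interval I fun x => ‖u x‖ := by
  refine ⟨fun a ha b hb => (hu.1 a ha b hb).norm, hu.2.1.norm, ?_⟩
  refine MemLp.mono hu.2.2 (measurable_deriv _).aestronglyMeasurable ?_
  filter_upwards [hu.ae_abs_deriv_norm_le hI] with x hx using hx

theorem integrableOn_norm_sq (hu : MemH1Interval I u) : IntegrableOn (fun x => ‖u x‖ ^ 2) I :=
  hu.2.1.integrable_norm_pow two_ne_zero

theorem integrableOn_norm_deriv_sq (hu : MemH1Interval I u) :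
    IntegrableOn (fun x => ‖deriv u x‖ ^ 2) I :=
  hu.2.2.integrable_norm_pow two_ne_zero

theorem continuousOn (hu : MemH1Interval I u) (hI : IsEdgeInterval I) : ContinuousOn u I := by
  rcases hI with ⟨L, hL, rfl⟩ | rfl
  · have := (hu.1 0 ⟨le_rfl, hL.le⟩ L ⟨hL.le, le_rfl⟩).continuousOn
    rwa [uIcc_of_le hL.le] at this
  · intro x hx
    have h0 : (0 : ℝ) ≤ x := hx
    have := (hu.1 0 self_mem_Ici (x + 1) (by simp; linarith)).continuousOn
    rw [uIcc_of_le (by linarith)] at this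
    refine (this x ⟨h0, by linarith⟩).mono_of_mem_nhdsWithin ?_
    rw [← Ici_inter_Iic]
    exact Filter.inter_mem self_mem_nhdsWithin
      (mem_nhdsWithin_of_mem_nhds (Iic_mem_nhds (by linarith)))

end MemH1Interval

end MetricGraph

/-! ### Real Sobolev functions on an edge: decay, maxima and integrability -/

namespace MetricGraph

namespace MemH1Interval

variable {I : Set ℝ} {u : ℝ → ℝ}

theorem integrableOn_sq (hu : MemH1Interval I u) : IntegrableOn (fun x => u x ^ 2) I := by
  simpa using hu.integrableOn_norm_sq

theorem integrableOn_deriv_sq (hu : MemH1Interval I u) :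
    IntegrableOn (fun x => deriv u x ^ 2) I := by
  simpa using hu.integrableOn_norm_deriv_sq

theorem integrableOn_mul_deriv (hu : MemH1Interval I u) :
    IntegrableOn (fun x => u x * deriv u x) I :=
  hu.2.1.integrable_mul hu.2.2

/-- The derivative `2 u u'` of `u ^ 2` is integrable, so `u ^ 2` has a limit at infinity;
integrability of `u ^ 2` forces this limit to be zero. -/
theorem tendsto_sq_atTop (hu : MemH1Interval (Ici 0) u) :
    Filter.Tendsto (fun x => u x ^ 2) Filter.atTop (nhds 0) := by
  have hint : IntegrableOn (fun x => 2 * (u x * deriv u x)) (Ioi 0) :=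
    (hu.integrableOn_mul_deriv.mono_set Ioi_subset_Ici_self).const_mul 2
  have hlim := (intervalIntegral_tendsto_integral_Ioi 0 hint Filter.tendsto_id).const_add (u 0 ^ 2)
  have heq : (fun x => u 0 ^ 2 + ∫ t in (0 : ℝ)..x, 2 * (u t * deriv u t)) =ᶠ[Filter.atTop]
      fun x => u x ^ 2 := by
    filter_upwards [Filter.eventually_ge_atTop 0] with x hx
    have hac := hu.1 0 self_mem_Ici x hx
    have h := hac.integral_deriv_mul_eq_sub hac
    have h' : ∫ t in (0 : ℝ)..x, 2 * (u t * deriv u t)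
        = ∫ t in (0 : ℝ)..x, deriv u t * u t + u t * deriv u t := by
      congr 1
      ext t
      ring
    rw [h', h]
    ring
  have hlim' := hlim.congr' heq
  have hint2 : IntegrableAtFilter (fun x => u x ^ 2) Filter.atTop volume :=
    ⟨Ici 0, Filter.Ici_mem_atTop 0, hu.integrableOn_sq⟩
  have := hint2.eq_zero_of_tendsto (fun s hs => by
    obtain ⟨b, hb⟩ := Filter.mem_atTop_sets.1 hs
    rw [← top_le_iff, ← Real.volume_Ici (a := b)]
    exact measure_mono hb) hlim'
  rwa [this] at hlim'

/-- On a half-line, decay at infinity confines the search for the maximum to a compact set as soon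
as `u` is nonzero somewhere. -/
theorem exists_forall_sq_le (hu : MemH1Interval I u) (hI : IsEdgeInterval I) :
    ∃ x ∈ I, ∀ y ∈ I, u y ^ 2 ≤ u x ^ 2 := by
  have hc : ContinuousOn (fun x => u x ^ 2) I := (hu.continuousOn hI).pow 2
  rcases id hI with ⟨L, hL, rfl⟩ | rfl
  · exact isCompact_Icc.exists_isMaxOn ⟨0, hI.zero_mem⟩ hc
  · by_cases h : ∃ x₀ ∈ Ici (0 : ℝ), 0 < u x₀ ^ 2
    · obtain ⟨x₀, hx₀, hpos⟩ := h
      refine hc.exists_isMaxOn' isClosed_Ici hx₀ ?_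
      have h1 := hu.tendsto_sq_atTop.eventually (gt_mem_nhds hpos)
      obtain ⟨b, hb⟩ := Filter.eventually_atTop.1 h1
      rw [Filter.eventually_inf_principal]
      filter_upwards [(isCompact_Icc (a := (0 : ℝ)) (b := b)).compl_mem_cocompact] with y hy hy0
      refine (hb y ?_).le
      by_contra hlt
      exact hy ⟨hy0, (not_le.1 hlt).le⟩
    · push Not at h
      exact ⟨0, self_mem_Ici, fun y hy => (h y hy).trans (sq_nonneg _)⟩

theorem integrableOn_pow_six (hu : MemH1Interval I u) (hI : IsEdgeInterval I) :
    IntegrableOn (fun x => u x ^ 6) I := by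
  obtain ⟨x₀, -, hmax⟩ := hu.exists_forall_sq_le hI
  refine Integrable.mono' (hu.integrableOn_sq.const_mul ((u x₀ ^ 2) ^ 2))
    (((hu.continuousOn hI).pow 6).aestronglyMeasurable hI.measurableSet) ?_
  refine (ae_restrict_mem hI.measurableSet).mono fun x hx => ?_
  have h1 := hmax x hx
  have h2 : (u x ^ 2) ^ 2 ≤ (u x₀ ^ 2) ^ 2 := by gcongr
  calc ‖u x ^ 6‖ = (u x ^ 2) ^ 2 * u x ^ 2 := by
        rw [Real.norm_of_nonneg (by positivity)]
        ring
    _ ≤ _ := by gcongr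

theorem const_mul (hu : MemH1Interval I u) (c : ℝ) : MemH1Interval I fun x => c * u x := by
  refine ⟨fun a ha b hb => (hu.1 a ha b hb).const_mul c, hu.2.1.const_mul c, ?_⟩
  have : deriv (fun x => c * u x) = fun x => c * deriv u x := by
    ext x
    exact deriv_const_mul_field c
  rw [this]
  exact hu.2.2.const_mul c

end MemH1Interval

/-! ### The calibration -/

/-- The primitive of `√(N ^ 2 - t ^ 2)`. -/
noncomputable def semicirclePrimitive (N s : ℝ) : ℝ := ∫ t in (0 : ℝ)..s, √(N ^ 2 - t ^ 2)

theorem continuous_semicircle (N : ℝ) : Continuous fun t : ℝ => √(N ^ 2 - t ^ 2) := by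
  fun_prop

theorem hasDerivAt_semicirclePrimitive (N s : ℝ) :
    HasDerivAt (semicirclePrimitive N) (√(N ^ 2 - s ^ 2)) s :=
  (continuous_semicircle N).integral_hasStrictDerivAt 0 s |>.hasDerivAt

theorem semicirclePrimitive_zero (N : ℝ) : semicirclePrimitive N 0 = 0 := by
  simp [semicirclePrimitive]

theorem contDiff_semicirclePrimitive (N : ℝ) : ContDiff ℝ 1 (semicirclePrimitive N) := by
  rw [contDiff_one_iff_deriv]
  refine ⟨fun x => (hasDerivAt_semicirclePrimitive N x).differentiableAt, ?_⟩
  have : deriv (semicirclePrimitive N) = fun t => √(N ^ 2 - t ^ 2) :=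
    funext fun x => (hasDerivAt_semicirclePrimitive N x).deriv
  rw [this]
  exact continuous_semicircle N

/-- The area of a quarter disc: this is where the constant `√3 π / 4` comes from. -/
theorem semicirclePrimitive_self {N : ℝ} (hN : 0 ≤ N) :
    semicirclePrimitive N N = Real.pi * N ^ 2 / 4 := by
  have h1 : ∫ t in (0 : ℝ)..1, √(1 - t ^ 2) = Real.pi / 4 := by
    have h := integral_sqrt_one_sub_sq
    have hi : ∀ a b : ℝ, IntervalIntegrable (fun t : ℝ => √(1 - t ^ 2)) volume a b := fun a b =>
      Continuous.intervalIntegrable (by fun_prop) a b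
    rw [← intervalIntegral.integral_add_adjacent_intervals (hi (-1) 0) (hi 0 1)] at h
    have h2 := intervalIntegral.integral_comp_neg (a := 0) (b := 1) fun t : ℝ => √(1 - t ^ 2)
    simp only [neg_sq, neg_zero] at h2
    linarith
  have h2 := intervalIntegral.mul_integral_comp_mul_left (a := 0) (b := 1)
    (f := fun t : ℝ => √(N ^ 2 - t ^ 2)) N
  simp only [mul_zero, mul_one] at h2
  rw [semicirclePrimitive, ← h2]
  have h3 : ∀ t : ℝ, √(N ^ 2 - (N * t) ^ 2) = N * √(1 - t ^ 2) := fun t => by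
    rw [show N ^ 2 - (N * t) ^ 2 = N ^ 2 * (1 - t ^ 2) by ring, Real.sqrt_mul (sq_nonneg _),
      Real.sqrt_sq hN]
  simp only [h3, intervalIntegral.integral_const_mul, h1]
  ring

/-- On `[S, N]` one has `N^2 - t^2 = (N - t)(N + t) ≤ 2N(N - S)`. The point is that the defect is of
order `(N - S)^(3/2)`, hence negligible compared with `N - S`. -/
theorem le_semicirclePrimitive {N S : ℝ} (hS : 0 ≤ S) (hSN : S ≤ N) :
    Real.pi * N ^ 2 / 4 - (N - S) * √(2 * N * (N - S)) ≤ semicirclePrimitive N S := by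
  have hi : ∀ a b : ℝ, IntervalIntegrable (fun t : ℝ => √(N ^ 2 - t ^ 2)) volume a b := fun a b =>
    (continuous_semicircle N).intervalIntegrable a b
  have h := intervalIntegral.integral_add_adjacent_intervals (hi 0 S) (hi S N)
  have hN := semicirclePrimitive_self (hS.trans hSN)
  have h2 : ∫ t in S..N, √(N ^ 2 - t ^ 2) ≤ ∫ _ in S..N, √(2 * N * (N - S)) := by
    refine intervalIntegral.integral_mono_on hSN (hi _ _) (by simp) fun t ht => ?_
    refine Real.sqrt_le_sqrt ?_
    nlinarith [ht.1, ht.2, mul_nonneg (sub_nonneg.2 ht.2) (hS.trans ht.1)]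
  simp only [intervalIntegral.integral_const, smul_eq_mul] at h2
  unfold semicirclePrimitive at *
  linarith

/-- Six times the energy density of `u`, shifted by `N ^ 2` times the mass density. -/
noncomputable def shiftedDensity (N : ℝ) (u : ℝ → ℝ) (x : ℝ) : ℝ :=
  3 * deriv u x ^ 2 - u x ^ 6 + N ^ 2 * u x ^ 2

/-- Expand the squares of `√3 u' ± √(N^2 - u^4) u`. The left-hand side is `√3` times the absolute
value of the derivative of `semicirclePrimitive N (u ^ 2)`. -/
theorem shiftedDensity_ge {N : ℝ} {u : ℝ → ℝ} {x : ℝ} (h : u x ^ 2 ≤ N) :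
    |√3 * (√(N ^ 2 - (u x ^ 2) ^ 2) * (2 * (u x * deriv u x)))| ≤ shiftedDensity N u x := by
  have hnn : 0 ≤ N ^ 2 - (u x ^ 2) ^ 2 := by nlinarith [sq_nonneg (u x)]
  have h1 := Real.sq_sqrt hnn
  have h3 : √3 ^ 2 = (3 : ℝ) := Real.sq_sqrt (by norm_num)
  unfold shiftedDensity
  rw [abs_le]
  constructor
  · nlinarith [sq_nonneg (√3 * deriv u x + √(N ^ 2 - (u x ^ 2) ^ 2) * u x)]
  · nlinarith [sq_nonneg (√3 * deriv u x - √(N ^ 2 - (u x ^ 2) ^ 2) * u x)]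

theorem shiftedDensity_nonneg {N : ℝ} {u : ℝ → ℝ} {x : ℝ} (h : u x ^ 2 ≤ N) :
    0 ≤ shiftedDensity N u x :=
  (abs_nonneg _).trans (shiftedDensity_ge h)

/-- The density with parameter `S` is already nonnegative, and raising the parameter to `N` adds
exactly `(N^2 - S^2) u^2`. -/
theorem mul_sq_le_shiftedDensity {N S : ℝ} {u : ℝ → ℝ} {x : ℝ} (h : u x ^ 2 ≤ S) :
    (N ^ 2 - S ^ 2) * u x ^ 2 ≤ shiftedDensity N u x := by
  have := shiftedDensity_nonneg h
  unfold shiftedDensity at *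
  linarith

theorem MemH1Interval.integrableOn_shiftedDensity {I : Set ℝ} {u : ℝ → ℝ}
    (hu : MemH1Interval I u) (hI : IsEdgeInterval I) (N : ℝ) :
    IntegrableOn (shiftedDensity N u) I :=
  ((hu.integrableOn_deriv_sq.const_mul 3).sub (hu.integrableOn_pow_six hI)).add
    (hu.integrableOn_sq.const_mul _)

/-- The calibration in integrated form. The fundamental theorem of calculus applies because a `C¹`
function is composed with the absolutely continuous `u ^ 2`, whose values stay in `[0, N]`. -/
theorem MemH1Interval.abs_semicirclePrimitive_sub_le {I : Set ℝ} {u : ℝ → ℝ} {N a b : ℝ}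
    (hu : MemH1Interval I u) (hI : IsEdgeInterval I) (ha : a ∈ I) (hb : b ∈ I) (hab : a ≤ b)
    (hN : ∀ x ∈ I, u x ^ 2 ≤ N) :
    √3 * |semicirclePrimitive N (u b ^ 2) - semicirclePrimitive N (u a ^ 2)|
      ≤ ∫ x in Icc a b, shiftedDensity N u x := by
  have hsub : Icc a b ⊆ I := hI.ordConnected.out ha hb
  have hac := hu.1 a ha b hb
  have hac2 : AbsolutelyContinuousOnInterval (fun x => u x ^ 2) a b := by
    simpa [sq] using hac.fun_mul hac
  have hac3 : AbsolutelyContinuousOnInterval (fun x => semicirclePrimitive N (u x ^ 2)) a b :=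
    hac2.contDiff_comp (c := 0) (d := N) (contDiff_semicirclePrimitive N).contDiffOn fun x hx =>
      ⟨sq_nonneg _, hN x (hsub (by rwa [uIcc_of_le hab] at hx))⟩
  rw [← hac3.integral_deriv_eq_sub, integral_Icc_eq_integral_Ioc,
    ← intervalIntegral.integral_of_le hab, ← abs_of_nonneg (Real.sqrt_nonneg 3), ← abs_mul,
    ← intervalIntegral.integral_const_mul]
  have hint := (hu.integrableOn_shiftedDensity hI N).mono_set
    ((Ioc_subset_Icc_self (a := a) (b := b)).trans hsub)
  rw [← intervalIntegrable_iff_integrableOn_Ioc_of_le hab] at hint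
  rw [← Real.norm_eq_abs]
  refine intervalIntegral.norm_integral_le_of_norm_le hab ?_ hint
  filter_upwards [hac.ae_differentiableAt] with x hx hxI
  have hxI' := Ioc_subset_Icc_self hxI
  have hd := (hx (by rwa [uIcc_of_le hab])).hasDerivAt
  have hd2 : HasDerivAt (fun x => u x ^ 2) (2 * (u x * deriv u x)) x := by
    simpa [mul_assoc] using hd.fun_pow 2
  have hd3 := (hasDerivAt_semicirclePrimitive N (u x ^ 2)).comp x hd2
  have heq : deriv (fun x => semicirclePrimitive N (u x ^ 2)) x = _ := hd3.deriv
  rw [heq, Real.norm_eq_abs]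
  exact shiftedDensity_ge (hN x (hsub hxI'))

/-- Let the right endpoint go to infinity: `u ^ 2` decays there and the primitive vanishes at `0`,
so only the term at `a` survives. -/
theorem MemH1Interval.semicirclePrimitive_le {u : ℝ → ℝ} {N a : ℝ}
    (hu : MemH1Interval (Ici 0) u) (ha : 0 ≤ a) (hN : ∀ x ∈ Ici (0 : ℝ), u x ^ 2 ≤ N) :
    √3 * semicirclePrimitive N (u a ^ 2) ≤ ∫ x in Ici a, shiftedDensity N u x := by
  have hI : IsEdgeInterval (Ici 0) := Or.inr rfl
  have hsub : Ici a ⊆ Ici (0 : ℝ) := Ici_subset_Ici.2 ha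
  have hlim : Filter.Tendsto (fun b => √3 * (semicirclePrimitive N (u a ^ 2) -
      semicirclePrimitive N (u b ^ 2))) Filter.atTop
      (nhds (√3 * (semicirclePrimitive N (u a ^ 2) - semicirclePrimitive N 0))) :=
    (((contDiff_semicirclePrimitive N).continuous.tendsto 0).comp
      hu.tendsto_sq_atTop).const_sub _ |>.const_mul _
  rw [semicirclePrimitive_zero, sub_zero] at hlim
  refine le_of_tendsto hlim ?_
  filter_upwards [Filter.eventually_ge_atTop a] with b hab
  have h1 := hu.abs_semicirclePrimitive_sub_le hI (a := a) (b := b) ha (ha.trans hab) hab hN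
  have h2 : ∫ x in Icc a b, shiftedDensity N u x ≤ ∫ x in Ici a, shiftedDensity N u x := by
    refine setIntegral_mono_set ((hu.integrableOn_shiftedDensity hI N).mono_set hsub) ?_
      Icc_subset_Ici_self.eventuallyLE
    exact (ae_restrict_mem measurableSet_Ici).mono fun x hx =>
      shiftedDensity_nonneg (hN x (hsub hx))
  refine (mul_le_mul_of_nonneg_left ?_ (Real.sqrt_nonneg 3)).trans (h1.trans h2)
  rw [abs_sub_comm]
  exact le_abs_self _

end MetricGraph

namespace MetricGraph

variable {V B H : Type*}

/-! ### Simple paths -/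

/-- The distinct vertices `v 0, …, v n` form a path, `v i` and `v (i + 1)` being joined by the
bounded edge `e i`. -/
structure IsChain (G : MetricGraph V B H) {n : ℕ} (v : Fin (n + 1) → V) (e : Fin n → B) :
    Prop where
  injective : Function.Injective v
  ends : ∀ i, (G.src (e i) = v i.castSucc ∧ G.tgt (e i) = v i.succ) ∨
    (G.src (e i) = v i.succ ∧ G.tgt (e i) = v i.castSucc)

/-- A path rather than a walk: distinct vertices force distinct edges, so that densities can be
summed along it without counting an edge twice. -/
theorem IsConnected.exists_isChain {G : MetricGraph V B H} (hG : G.IsConnected) (a c : V) :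
    ∃ (n : ℕ) (v : Fin (n + 1) → V) (e : Fin n → B),
      G.IsChain v e ∧ v 0 = a ∧ v (Fin.last n) = c := by
  classical
  obtain ⟨p, hp⟩ := (hG.preconnected a c).exists_isPath
  have hadj : ∀ i : Fin p.length, ∃ b, (G.src b = p.getVert i ∧ G.tgt b = p.getVert (i + 1)) ∨
      (G.src b = p.getVert (i + 1) ∧ G.tgt b = p.getVert i) := fun i => by
    have h := p.adj_getVert_succ i.2
    rw [SimpleGraph.fromRel_adj] at h
    rcases h.2 with ⟨b, hb⟩ | ⟨b, hb⟩
    · exact ⟨b, Or.inl hb⟩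
    · exact ⟨b, Or.inr hb⟩
  choose e he using hadj
  refine ⟨p.length, fun i => p.getVert i, e, ⟨fun i j hij => ?_, fun i => ?_⟩, by simp, by simp⟩
  · exact Fin.ext (hp.getVert_injOn (Nat.lt_succ_iff.1 i.2) (Nat.lt_succ_iff.1 j.2) hij)
  · simpa using he i

namespace IsChain

variable {G : MetricGraph V B H} {n : ℕ} {v : Fin (n + 1) → V} {e : Fin n → B}

/-- Equal edges have equal endpoints, and the unordered pair `{i, i + 1}` determines `i`. -/
theorem injective_edge (h : G.IsChain v e) : Function.Injective e := by
  intro i j hij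
  have hi := h.ends i
  have hj := h.ends j
  rw [hij] at hi
  have key : ∀ a b : Fin (n + 1), v a = v b → (a : ℕ) = b := fun a b hab =>
    congrArg Fin.val (h.injective hab)
  ext
  rcases hi with ⟨h1, h2⟩ | ⟨h1, h2⟩ <;> rcases hj with ⟨h3, h4⟩ | ⟨h3, h4⟩ <;>
    (have h5 := key _ _ (h1.symm.trans h3)
     have h6 := key _ _ (h2.symm.trans h4)
     simp at h5 h6
     omega)

/-- Telescoping; the absolute values make the orientation of the edges irrelevant. -/
theorem sub_le_sum (h : G.IsChain v e) (F : V → ℝ) :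
    F (v 0) - F (v (Fin.last n)) ≤ ∑ i, |F (G.src (e i)) - F (G.tgt (e i))| := by
  have h1 := Fin.sum_univ_succ fun i => F (v i)
  rw [Fin.sum_univ_castSucc] at h1
  have h2 : F (v 0) - F (v (Fin.last n)) = ∑ i : Fin n, (F (v i.castSucc) - F (v i.succ)) := by
    rw [Finset.sum_sub_distrib]
    linarith
  rw [h2]
  refine Finset.sum_le_sum fun i _ => ?_
  rcases h.ends i with ⟨h3, h4⟩ | ⟨h3, h4⟩ <;> rw [h3, h4]
  · exact le_abs_self _
  · rw [abs_sub_comm]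
    exact le_abs_self _

/-- The end of a path obtained by removing the first edge. -/
theorem tail {v : Fin (n + 2) → V} {e : Fin (n + 1) → B} (h : G.IsChain v e) :
    G.IsChain (v ∘ Fin.succ) (e ∘ Fin.succ) :=
  ⟨h.injective.comp (Fin.succ_injective _), fun i => by
    have := h.ends i.succ
    rwa [← Fin.succ_castSucc] at this⟩

end IsChain

/-- From one of the ends of a bounded edge there is a path to any given vertex which does not use
this edge. -/
theorem IsConnected.exists_isChain_notMem {G : MetricGraph V B H} (hG : G.IsConnected) (b : B)
    (c : V) : ∃ (n : ℕ) (v : Fin (n + 1) → V) (e : Fin n → B),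
      G.IsChain v e ∧ (v 0 = G.src b ∨ v 0 = G.tgt b) ∧ v (Fin.last n) = c ∧ b ∉ range e := by
  obtain ⟨n, v, e, h, h0, hn⟩ := hG.exists_isChain (G.src b) c
  by_cases hb : b ∈ range e
  · obtain ⟨i, hi⟩ := hb
    cases n with
    | zero => exact i.elim0
    | succ n =>
      -- The path visits `src b` only at its start, so if it uses `b` then `b` is its first edge.
      -- Dropping that edge leaves a path from `tgt b`.
      have hi0 : i = 0 ∧ G.tgt b = v 1 := by
        have := h.ends i
        rw [hi, ← h0] at this
        rcases this with ⟨h1, h2⟩ | ⟨h1, -⟩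
        · have h3 : i = 0 := by
            have := h.injective h1
            exact Fin.castSucc_eq_zero_iff.1 this.symm
          subst h3
          exact ⟨rfl, h2⟩
        · exact absurd (h.injective h1).symm (Fin.succ_ne_zero i)
      obtain ⟨rfl, h2⟩ := hi0
      refine ⟨n, _, _, h.tail, Or.inr h2.symm, hn, ?_⟩
      rintro ⟨j, hj⟩
      exact Fin.succ_ne_zero j (h.injective_edge (hj.trans hi.symm))
  · exact ⟨n, v, e, h, Or.inl h0, hn, hb⟩

end MetricGraph

namespace MetricGraph

variable {V B H : Type*}

/-! ### Graphs isometric to a half-line -/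

theorem IsRoute.symm {G : MetricGraph V B H} {p q : G.Point} {L : ℝ} (h : G.IsRoute p q L) :
    G.IsRoute q p L := by
  induction h with
  | along p q h => rw [abs_sub_comm]; exact .along q p h.symm
  | glue p q v hp hq => exact .glue q p v hq hp
  | trans p q r L M _ _ h1 h2 => rw [add_comm]; exact .trans r q p M L h2 h1

/-- A function on a metric graph whose increments are realised as lengths of routes and which is
`1`-Lipschitz along edges defines an isometry onto its range. -/
theorem edist_eq_dist_of_forall_isRoute {G : MetricGraph V B H} (f : G.Point → ℝ≥0)
    (halong : ∀ p q : G.Point, p.edge = q.edge → |(f p : ℝ) - f q| ≤ |p.coord - q.coord|)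
    (hglue : ∀ (p q : G.Point) (v : V), G.AtVertex p.edge p.coord v → G.AtVertex q.edge q.coord v →
      f p = f q)
    (hroute : ∀ p q : G.Point, G.IsRoute p q |(f p : ℝ) - f q|) (p q : G.Point) :
    edist (f p) (f q) = G.dist p q := by
  have key : ∀ {p q : G.Point} {L : ℝ}, G.IsRoute p q L → |(f p : ℝ) - f q| ≤ L := by
    intro p q L h
    induction h with
    | along p q h => exact halong p q h
    | glue p q v hp hq => simp [hglue p q v hp hq]
    | trans p q r L M _ _ h1 h2 => exact (abs_sub_le _ _ _).trans (add_le_add h1 h2)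
  rw [edist_dist, NNReal.dist_eq]
  refine le_antisymm (le_iInf₂ fun L hL => ENNReal.ofReal_le_ofReal (key hL)) ?_
  exact iInf₂_le _ (hroute p q)

/-- The sum of the lengths of the first `k` edges of the path `e`. -/
noncomputable def partialLength (G : MetricGraph V B H) {n : ℕ} (e : Fin n → B) (k : ℕ) : ℝ :=
  ∑ j : Fin n, if (j : ℕ) < k then G.len (e j) else 0

theorem partialLength_zero (G : MetricGraph V B H) {n : ℕ} (e : Fin n → B) :
    G.partialLength e 0 = 0 := by
  simp [partialLength]

theorem partialLength_succ (G : MetricGraph V B H) {n : ℕ} (e : Fin n → B) (i : Fin n) :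
    G.partialLength e (i + 1) = G.partialLength e i + G.len (e i) := by
  have : G.len (e i) = ∑ j : Fin n, if j = i then G.len (e j) else 0 := by simp
  rw [this, partialLength, partialLength, ← Finset.sum_add_distrib]
  refine Finset.sum_congr rfl fun j _ => ?_
  by_cases h : j = i
  · subst h
    simp
  · have : (j : ℕ) ≠ i := fun h' => h (Fin.ext h')
    have : (j : ℕ) < i + 1 ↔ (j : ℕ) < i := by omega
    simp [h, this]

theorem partialLength_mono (G : MetricGraph V B H) {n : ℕ} (e : Fin n → B) :
    Monotone (G.partialLength e) := by
  intro k l hkl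
  refine Finset.sum_le_sum fun j _ => ?_
  split_ifs with h1 h2 h2
  · exact le_rfl
  · omega
  · exact (G.len_pos _).le
  · exact le_rfl

/-- A graph with only one half-line, whose bounded edges form a path ending at the vertex of the
half-line, is isometric to `[0, ∞)`. -/
theorem IsChain.isometricToHalfLine {G : MetricGraph V B H} {n : ℕ} {v : Fin (n + 1) → V}
    {e : Fin n → B} (hc : G.IsChain v e) (he : Function.Surjective e) (h : H)
    (hh : ∀ h', h' = h) (hroot : v (Fin.last n) = G.root h) : G.IsometricToHalfLine := by
  classical
  set ε : B ≃ Fin n := (Equiv.ofBijective e ⟨hc.injective_edge, he⟩).symm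
  have heε : ∀ b, e (ε b) = b := fun b =>
    (Equiv.ofBijective e ⟨hc.injective_edge, he⟩).apply_symm_apply b
  have hεe : ∀ i, ε (e i) = i := fun i =>
    (Equiv.ofBijective e ⟨hc.injective_edge, he⟩).symm_apply_apply i
  let pos := G.partialLength e
  have hpos : ∀ i : Fin n, pos (i + 1) = pos i + G.len (e i) := G.partialLength_succ e
  have hmono : Monotone pos := G.partialLength_mono e
  have hpos0 : pos 0 = 0 := G.partialLength_zero e
  -- `idx` is the rank of an edge along the path, the half-line coming last; `loc` is the coordinate
  -- measured from the end of the edge reached first; `ht` is the arc length from `v 0`, which will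
  -- be the isometry.
  let idx : B ⊕ H → ℕ := Sum.elim (fun b => ε b) fun _ => n
  let loc : B ⊕ H → ℝ → ℝ := Sum.elim
    (fun b x => if G.src b = v (ε b).castSucc then x else G.len b - x) fun _ x => x
  let ht : B ⊕ H → ℝ → ℝ := fun E x => pos (idx E) + loc E x
  have hidx : ∀ E E', idx E = idx E' → E = E' := by
    rintro (b | b) (b' | b') hE
    · exact congrArg _ (ε.injective (Fin.ext hE))
    · exact absurd hE (ε b).2.ne
    · exact absurd hE.symm (ε b').2.ne
    · rw [hh b, hh b']
  have hidx_le : ∀ E, idx E ≤ n := by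
    rintro (b | b)
    · exact (ε b).2.le
    · exact le_rfl
  have hsame : ∀ E x y, |ht E x - ht E y| = |x - y| := by
    rintro (b | b) x y
    · simp only [ht, loc, Sum.elim_inl]
      split_ifs
      · congr 1; ring
      · rw [abs_sub_comm x y]; congr 1; ring
    · simp only [ht, loc, Sum.elim_inr]
      congr 1; ring
  have hne : ∀ i : Fin n, v i.succ ≠ v i.castSucc := fun i hi => by
    have := congrArg Fin.val (hc.injective hi)
    simp at this
  have hvert : ∀ E x w, G.AtVertex E x w → ∃ k : Fin (n + 1), w = v k ∧ ht E x = pos k := by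
    rintro E x w (b | b | h')
    · have hb := hc.ends (ε b)
      rw [heε] at hb
      rcases hb with ⟨h1, h2⟩ | ⟨h1, h2⟩
      · exact ⟨_, h1, by simp [ht, idx, loc, h1]⟩
      · exact ⟨_, h1, by simp [ht, idx, loc, h1, hne, hpos, heε]⟩
    · have hb := hc.ends (ε b)
      rw [heε] at hb
      rcases hb with ⟨h1, h2⟩ | ⟨h1, h2⟩
      · exact ⟨_, h2, by simp [ht, idx, loc, h1, hpos, heε]⟩
      · exact ⟨_, h2, by simp [ht, idx, loc, h1, hne]⟩
    · exact ⟨Fin.last n, by rw [hh h', hroot], by simp [ht, idx, loc]⟩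
  have hstart : ∀ k : Fin (n + 1), ∃ z : G.Point, idx z.edge = k ∧
      G.AtVertex z.edge z.coord (v k) := by
    intro k
    induction k using Fin.lastCases with
    | last =>
      refine ⟨⟨.inr h, 0, self_mem_Ici⟩, by simp [idx], ?_⟩
      rw [hroot]
      exact .root h
    | cast i =>
      rcases hc.ends i with ⟨h1, h2⟩ | ⟨h1, h2⟩
      · refine ⟨⟨.inl (e i), 0, le_rfl, (G.len_pos _).le⟩, by simp [idx, hεe], ?_⟩
        rw [← h1]
        exact .src _
      · refine ⟨⟨.inl (e i), G.len (e i), (G.len_pos _).le, le_rfl⟩, by simp [idx, hεe], ?_⟩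
        rw [← h2]
        exact .tgt _
  have hend : ∀ E (hE : idx E < n), ∃ z : G.Point, z.edge = E ∧
      G.AtVertex z.edge z.coord (v ⟨idx E + 1, by omega⟩) := by
    rintro (b | b) hE
    · have hb := hc.ends (ε b)
      rw [heε] at hb
      rcases hb with ⟨h1, h2⟩ | ⟨h1, h2⟩
      · refine ⟨⟨.inl b, G.len b, (G.len_pos _).le, le_rfl⟩, rfl, ?_⟩
        have : v ⟨idx (.inl b) + 1, by omega⟩ = G.tgt b := h2.symm
        rw [this]
        exact .tgt _
      · refine ⟨⟨.inl b, 0, le_rfl, (G.len_pos _).le⟩, rfl, ?_⟩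
        have : v ⟨idx (.inl b) + 1, by omega⟩ = G.src b := h1.symm
        rw [this]
        exact .src _
    · exact absurd hE (lt_irrefl n)
  have hge : ∀ p : G.Point, pos (idx p.edge) ≤ ht p.edge p.coord := by
    rintro ⟨b | b, x, hx⟩
    · simp only [ht, loc, Sum.elim_inl]
      split_ifs
      · linarith [hx.1]
      · linarith [hx.2]
    · have : (0 : ℝ) ≤ x := hx
      simp only [ht, loc, Sum.elim_inr]
      linarith
  have hle : ∀ p : G.Point, idx p.edge < n → ht p.edge p.coord ≤ pos (idx p.edge + 1) := by
    rintro ⟨b | b, x, hx⟩ hlt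
    · have h1 := hpos (ε b)
      rw [heε] at h1
      simp only [ht, idx, loc, Sum.elim_inl, h1]
      split_ifs
      · linarith [hx.2]
      · linarith [hx.1]
    · exact absurd hlt (lt_irrefl n)
  have hnn : ∀ p : G.Point, 0 ≤ ht p.edge p.coord := fun p =>
    (hpos0.symm.le.trans (hmono (Nat.zero_le _))).trans (hge p)
  -- Induction on the number of edges separating the points: go to the far end of the edge of `p`,
  -- cross the vertex, continue. The values of `ht` increase along this route, so its length is
  -- exactly the increment.
  have hroute : ∀ (d : ℕ) (p q : G.Point), idx q.edge = idx p.edge + d →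
      G.IsRoute p q |ht p.edge p.coord - ht q.edge q.coord| := by
    intro d
    induction d with
    | zero =>
      intro p q hpq
      have hE : p.edge = q.edge := hidx _ _ hpq.symm
      rw [hE, hsame]
      exact .along p q hE
    | succ d ih =>
      intro p q hpq
      have hlt : idx p.edge < n := by
        have := hidx_le q.edge
        omega
      obtain ⟨z, hz, hzv⟩ := hend p.edge hlt
      obtain ⟨z', hz', hzv'⟩ := hstart ⟨idx p.edge + 1, by omega⟩
      have hval : ∀ y : G.Point, G.AtVertex y.edge y.coord (v ⟨idx p.edge + 1, by omega⟩) →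
          ht y.edge y.coord = pos (idx p.edge + 1) := fun y hy => by
        obtain ⟨k, hk, hk'⟩ := hvert _ _ _ hy
        rw [hk', ← hc.injective hk]
      have h1 : p.edge = z.edge → G.IsRoute p z |p.coord - z.coord| := .along p z
      have h2 : G.IsRoute z z' 0 := .glue z z' _ hzv hzv'
      have h3 := ih z' q (by rw [hz', hpq]; simp only; omega)
      have h4 := (IsRoute.trans _ _ _ _ _ (.trans _ _ _ _ _ (h1 hz.symm) h2) h3)
      convert h4 using 1
      have h5 : |p.coord - z.coord| = |ht p.edge p.coord - ht z.edge z.coord| := by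
        rw [hz, hsame]
      rw [h5, hval z hzv, hval z' hzv', abs_of_nonpos, abs_of_nonpos, abs_of_nonpos]
      · ring
      · have := (hmono (by omega : idx p.edge + 1 ≤ idx q.edge)).trans (hge q)
        linarith
      · linarith [hle p hlt]
      · have := (hmono (by omega : idx p.edge + 1 ≤ idx q.edge)).trans (hge q)
        linarith [hle p hlt]
  refine ⟨fun p => ⟨ht p.edge p.coord, hnn p⟩, ?_, edist_eq_dist_of_forall_isRoute _ ?_ ?_ ?_⟩
  · intro y
    have hk0 : pos 0 ≤ y := hpos0.le.trans y.2
    -- The height `y` is reached on the edge of rank `k`, the last one that starts at or below `y`;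
    -- rank `n` means the half-line.
    set k := Nat.findGreatest (fun k => pos k ≤ y) n with hk
    have hkn : k ≤ n := Nat.findGreatest_le n
    have hk1 : pos k ≤ y := Nat.findGreatest_spec (P := fun k => pos k ≤ y) (Nat.zero_le n) hk0
    rcases hkn.lt_or_eq with hlt | heq
    · have hk2 : (y : ℝ) < pos (k + 1) :=
        not_le.1 (Nat.findGreatest_is_greatest (P := fun k => pos k ≤ y) (Nat.lt_succ_self _) hlt)
      have h1 := hpos ⟨k, hlt⟩
      simp only at h1
      by_cases hs : G.src (e ⟨k, hlt⟩) = v (Fin.castSucc ⟨k, hlt⟩)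
      · refine ⟨⟨.inl (e ⟨k, hlt⟩), y - pos k, by linarith, by linarith⟩, ?_⟩
        ext
        simp only [Fin.castSucc_mk] at hs
        simp [ht, idx, loc, hεe, hs]
        rfl
      · refine ⟨⟨.inl (e ⟨k, hlt⟩), G.len (e ⟨k, hlt⟩) - (y - pos k), by linarith, by linarith⟩, ?_⟩
        ext
        simp only [Fin.castSucc_mk] at hs
        simp [ht, idx, loc, hεe, hs]
        rfl
    · refine ⟨⟨.inr h, y - pos n, ?_⟩, ?_⟩
      · have : pos n ≤ y := heq ▸ hk1
        exact sub_nonneg.2 this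
      · ext
        simp [ht, idx, loc]
        rfl
  · intro p q hpq
    change |ht p.edge p.coord - ht q.edge q.coord| ≤ _
    rw [hpq, hsame]
  · intro p q w hp hq
    obtain ⟨k, hk, hk'⟩ := hvert _ _ _ hp
    obtain ⟨l, hl, hl'⟩ := hvert _ _ _ hq
    ext
    change ht p.edge p.coord = ht q.edge q.coord
    rw [hk', hl', hc.injective (hk.symm.trans hl)]
  · intro p q
    change G.IsRoute p q |ht p.edge p.coord - ht q.edge q.coord|
    rcases le_total (idx p.edge) (idx q.edge) with h1 | h1
    · exact hroute (idx q.edge - idx p.edge) p q (by omega)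
    · rw [abs_sub_comm]
      exact (hroute (idx p.edge - idx q.edge) q p (by omega)).symm

end MetricGraph

namespace MetricGraph

variable {V B H : Type*} {G : MetricGraph V B H} {u : B ⊕ H → ℝ → ℝ}

/-! ### The calibration on a graph -/

theorem MemH1.exists_forall_sq_le [Finite B] [Finite H] (hu : G.MemH1 u) (hH : Nonempty H) :
    ∃ e, ∃ x ∈ G.interval e, ∀ e', ∀ y ∈ G.interval e', u e' y ^ 2 ≤ u e x ^ 2 := by
  choose x hx hmax using fun e => (hu.1 e).exists_forall_sq_le (G.isEdgeInterval_interval e)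
  obtain ⟨h⟩ := hH
  have : Nonempty (B ⊕ H) := ⟨.inr h⟩
  obtain ⟨e, he⟩ := Finite.exists_max fun e => u e (x e) ^ 2
  exact ⟨e, x e, hx e, fun e' y hy => (hmax e' y hy).trans (he e')⟩

theorem volume_interval_ne_zero (G : MetricGraph V B H) (e : B ⊕ H) :
    volume (G.interval e) ≠ 0 := by
  cases e with
  | inl b => simpa [interval] using G.len_pos b
  | inr h => simp [interval]

/-- Each edge of the path pays for the change of `semicirclePrimitive N (φ ^ 2)` between its ends,
and the half-line pays for the value left at its root. -/
theorem IsChain.semicirclePrimitive_le [Finite B] [Finite H] {n : ℕ} {v : Fin (n + 1) → V}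
    {e : Fin n → B} (hc : G.IsChain v e) {h : H} (hroot : v (Fin.last n) = G.root h)
    (hu : G.MemH1 u) {φ : V → ℝ} (hφ : ∀ e x v, G.AtVertex e x v → u e x = φ v) {N : ℝ}
    (hN : ∀ e, ∀ y ∈ G.interval e, u e y ^ 2 ≤ N) :
    √3 * semicirclePrimitive N (φ (v 0) ^ 2) ≤
      (∑ i, ∫ x in G.interval (.inl (e i)), shiftedDensity N (u (.inl (e i))) x) +
        ∫ x in G.interval (.inr h), shiftedDensity N (u (.inr h)) x := by
  have h1 := mul_le_mul_of_nonneg_left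
    (hc.sub_le_sum fun w => semicirclePrimitive N (φ w ^ 2)) (Real.sqrt_nonneg 3)
  have h2 := (hu.1 (.inr h)).semicirclePrimitive_le le_rfl (hN (.inr h))
  rw [hφ _ _ _ (.root h), ← hroot] at h2
  rw [Finset.mul_sum] at h1
  have h3 : ∑ i, √3 * |semicirclePrimitive N (φ (G.src (e i)) ^ 2) -
      semicirclePrimitive N (φ (G.tgt (e i)) ^ 2)| ≤
      ∑ i, ∫ x in G.interval (.inl (e i)), shiftedDensity N (u (.inl (e i))) x := by
    refine Finset.sum_le_sum fun i _ => ?_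
    have := (hu.1 (.inl (e i))).abs_semicirclePrimitive_sub_le (G.isEdgeInterval_interval _)
      (a := 0) (b := G.len (e i)) ⟨le_rfl, (G.len_pos _).le⟩ ⟨(G.len_pos _).le, le_rfl⟩
      (G.len_pos _).le (hN _)
    rwa [hφ _ _ _ (.src _), hφ _ _ _ (.tgt _), abs_sub_comm] at this
  have h4 : ∫ x in G.interval (.inr h), shiftedDensity N (u (.inr h)) x =
    ∫ x in Ici 0, shiftedDensity N (u (.inr h)) x := rfl
  rw [h4]
  linarith

theorem setIntegral_shiftedDensity_nonneg {N : ℝ} {e : B ⊕ H} {J : Set ℝ} (hJ : MeasurableSet J)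
    (hJe : J ⊆ G.interval e) (hN : ∀ y ∈ G.interval e, u e y ^ 2 ≤ N) :
    0 ≤ ∫ x in J, shiftedDensity N (u e) x :=
  setIntegral_nonneg hJ fun x hx => shiftedDensity_nonneg (hN x (hJe hx))

/-- The part of a graph consisting of the bounded edges in `s`, of the half-line `h`, and of the
parts `J b` of the other bounded edges `b`. -/
def pathSet [DecidableEq B] [DecidableEq H] (G : MetricGraph V B H) (s : Finset B) (h : H)
    (J : B → Set ℝ) : B ⊕ H → Set ℝ :=
  Sum.elim (fun b => if b ∈ s then G.interval (.inl b) else J b)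
    fun h' => if h' = h then G.interval (.inr h') else ∅

theorem measurableSet_pathSet [DecidableEq B] [DecidableEq H] (s : Finset B) (h : H)
    {J : B → Set ℝ} (hJ : ∀ b, MeasurableSet (J b)) (E : B ⊕ H) :
    MeasurableSet (G.pathSet s h J E) := by
  have hmeas : ∀ E, MeasurableSet (G.interval E) := fun E =>
    (G.isEdgeInterval_interval E).measurableSet
  rcases E with b | b <;> simp only [pathSet, Sum.elim_inl, Sum.elim_inr] <;> split_ifs
  exacts [hmeas _, hJ b, hmeas _, .empty]

theorem pathSet_subset [DecidableEq B] [DecidableEq H] (s : Finset B) (h : H)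
    {J : B → Set ℝ} (hJ : ∀ b, J b ⊆ G.interval (.inl b)) (E : B ⊕ H) :
    G.pathSet s h J E ⊆ G.interval E := by
  rcases E with b | b <;> simp only [pathSet, Sum.elim_inl, Sum.elim_inr] <;> split_ifs
  exacts [subset_rfl, hJ b, subset_rfl, empty_subset _]

/-- Since `pathSet` takes the edges of the path in full, only the pieces `J b` off the path
contribute in addition to the bound along the path. -/
theorem IsChain.add_sum_compl_le [Fintype B] [Fintype H] [DecidableEq B] [DecidableEq H] {n : ℕ}
    {v : Fin (n + 1) → V} {e : Fin n → B} (hc : G.IsChain v e) {h : H}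
    (hroot : v (Fin.last n) = G.root h) (hu : G.MemH1 u) {φ : V → ℝ}
    (hφ : ∀ e x v, G.AtVertex e x v → u e x = φ v) {N : ℝ}
    (hN : ∀ e, ∀ y ∈ G.interval e, u e y ^ 2 ≤ N) (J : B → Set ℝ) :
    √3 * semicirclePrimitive N (φ (v 0) ^ 2) +
        ∑ b ∈ (Finset.univ.image e)ᶜ, ∫ x in J b, shiftedDensity N (u (.inl b)) x ≤
      ∑ E : B ⊕ H, ∫ x in G.pathSet (Finset.univ.image e) h J E, shiftedDensity N (u E) x := by
  have h1 := hc.semicirclePrimitive_le hroot hu hφ hN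
  rw [Fintype.sum_sum_type]
  simp only [pathSet, Sum.elim_inl, Sum.elim_inr]
  have h2 : ∑ h', ∫ x in (if h' = h then G.interval (.inr h') else ∅),
      shiftedDensity N (u (.inr h')) x =
      ∫ x in G.interval (.inr h), shiftedDensity N (u (.inr h)) x := by
    rw [Finset.sum_eq_single h]
    · simp
    · intro h' _ hne
      simp [hne]
    · simp
  have h3 : ∑ b, ∫ x in (if b ∈ Finset.univ.image e then G.interval (.inl b) else J b),
      shiftedDensity N (u (.inl b)) x =
      (∑ i, ∫ x in G.interval (.inl (e i)), shiftedDensity N (u (.inl (e i))) x) +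
        ∑ b ∈ (Finset.univ.image e)ᶜ, ∫ x in J b, shiftedDensity N (u (.inl b)) x := by
    rw [← Finset.sum_add_sum_compl (Finset.univ.image e)]
    congr 1
    · rw [Finset.sum_image hc.injective_edge.injOn]
      refine Finset.sum_congr rfl fun i _ => ?_
      rw [if_pos (Finset.mem_image_of_mem e (Finset.mem_univ i))]
    · refine Finset.sum_congr rfl fun b hb => ?_
      rw [if_neg (Finset.mem_compl.1 hb)]
  rw [h2, h3]
  linarith

theorem volume_Icc_diff_ne_zero {a b c d : ℝ} (h : ∃ x y, x < y ∧ Ioo x y ⊆ Icc a b \ Icc c d) :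
    volume (Icc a b \ Icc c d) ≠ 0 := by
  obtain ⟨x, y, hxy, hsub⟩ := h
  intro h0
  have := measure_mono_null hsub h0
  simp at this
  linarith

/-- From every point of a connected non-compact graph one can escape to infinity along a part `T` of
the graph in such a way that the shifted energy on `T` is bounded below in terms of the value at the
starting point only. If the whole graph is used, it is isometric to `[0, ∞)`. -/
theorem MemH1.exists_escape [Fintype B] [Fintype H] (hconn : G.IsConnected) (hH : Nonempty H)
    (hu : G.MemH1 u) {e : B ⊕ H} {x : ℝ} (hx : x ∈ G.interval e) :
    ∃ T : B ⊕ H → Set ℝ, (∀ E, MeasurableSet (T E)) ∧ (∀ E, T E ⊆ G.interval E) ∧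
      (∀ N, (∀ E, ∀ y ∈ G.interval E, u E y ^ 2 ≤ N) →
        √3 * semicirclePrimitive N (u e x ^ 2) ≤ ∑ E, ∫ y in T E, shiftedDensity N (u E) y) ∧
      ((∀ E, volume (G.interval E \ T E) = 0) → G.IsometricToHalfLine) := by
  classical
  obtain ⟨h₀⟩ := hH
  obtain ⟨φ, hφ⟩ := hu.2
  -- From a vertex, `T` is a simple path followed by a half-line. From an interior point of an edge,
  -- `T` omits a piece of that edge of positive length, so the last clause holds vacuously.
  by_cases hv : ∃ w, G.AtVertex e x w
  · obtain ⟨w, hw⟩ := hv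
    obtain ⟨n, v, p, hc, h0, hn⟩ := hconn.exists_isChain w (G.root h₀)
    refine ⟨G.pathSet (Finset.univ.image p) h₀ fun _ => ∅,
      measurableSet_pathSet _ _ fun _ => .empty,
      pathSet_subset _ _ fun _ => empty_subset _, fun N hN => ?_, fun hvol => ?_⟩
    · have := hc.add_sum_compl_le hn hu hφ hN fun _ => ∅
      simp only [Measure.restrict_empty, integral_zero_measure, Finset.sum_const_zero, add_zero,
        h0] at this
      rw [hφ e x w hw]
      exact this
    · refine hc.isometricToHalfLine (fun b => ?_) h₀ (fun h' => ?_) hn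
      · by_contra hb
        have := hvol (.inl b)
        rw [pathSet, Sum.elim_inl, if_neg (by simpa using hb), sdiff_empty] at this
        exact G.volume_interval_ne_zero _ this
      · by_contra hb
        have := hvol (.inr h')
        rw [pathSet, Sum.elim_inr, if_neg hb, sdiff_empty] at this
        exact G.volume_interval_ne_zero _ this
  · cases e with
    | inr h =>
      have hx0 : 0 < x := lt_of_le_of_ne hx fun h0 => hv ⟨_, h0 ▸ AtVertex.root h⟩
      have hsub : Ici x ⊆ G.interval (.inr h) := Ici_subset_Ici.2 hx0.le
      refine ⟨Function.update (fun _ => ∅) (.inr h) (Ici x), ?_, ?_, fun N hN => ?_, fun hvol => ?_⟩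
      · intro E
        by_cases hE : E = .inr h
        · subst hE
          simp [measurableSet_Ici]
        · simp [hE]
      · intro E
        by_cases hE : E = .inr h
        · subst hE
          simpa using hsub
        · simp [hE]
      · rw [Finset.sum_eq_single (.inr h)]
        · rw [Function.update_self]
          exact (hu.1 (.inr h)).semicirclePrimitive_le hx0.le (hN (.inr h))
        · intro E _ hE
          simp [hE]
        · simp
      · exfalso
        have h1 := hvol (.inr h)
        rw [Function.update_self] at h1
        have h2 : Ico 0 x ⊆ G.interval (.inr h) \ Ici x := fun y hy => ⟨hy.1, not_le.2 hy.2⟩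
        have h3 := measure_mono_null h2 h1
        simp at h3
        linarith
    | inl b =>
      have hx0 : 0 < x := lt_of_le_of_ne hx.1 fun h0 => hv ⟨_, h0 ▸ AtVertex.src b⟩
      have hxl : x < G.len b := lt_of_le_of_ne hx.2 fun h0 => hv ⟨_, h0 ▸ AtVertex.tgt b⟩
      -- The path avoids `b`, so the segment of `b` joining the point to the start of the path can
      -- be added to `T` without overlap.
      obtain ⟨n, v, p, hc, h0, hn, hb⟩ := hconn.exists_isChain_notMem b (G.root h₀)
      have hbmem : b ∈ (Finset.univ.image p)ᶜ := by simpa using hb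
      obtain ⟨c, d, hc0, hcd, hd, hbound, hne⟩ : ∃ c d : ℝ, 0 ≤ c ∧ c ≤ d ∧ d ≤ G.len b ∧
          (∀ N, (∀ E, ∀ y ∈ G.interval E, u E y ^ 2 ≤ N) →
            √3 * semicirclePrimitive N (u (.inl b) x ^ 2) ≤
              √3 * semicirclePrimitive N (φ (v 0) ^ 2) +
                ∫ y in Icc c d, shiftedDensity N (u (.inl b)) y) ∧
          volume (Icc 0 (G.len b) \ Icc c d) ≠ 0 := by
        have h0I : (0 : ℝ) ∈ G.interval (.inl b) := ⟨le_rfl, (G.len_pos b).le⟩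
        have hlI : G.len b ∈ G.interval (.inl b) := ⟨(G.len_pos b).le, le_rfl⟩
        rcases h0 with h0 | h0
        · refine ⟨0, x, le_rfl, hx0.le, hxl.le, fun N hN => ?_, volume_Icc_diff_ne_zero
            ⟨x, G.len b, hxl, fun y hy => ⟨⟨by linarith [hy.1], hy.2.le⟩, fun h => ?_⟩⟩⟩
          · have := (hu.1 (.inl b)).abs_semicirclePrimitive_sub_le (G.isEdgeInterval_interval _)
              h0I hx hx0.le (hN _)
            rw [hφ _ _ _ (.src b), ← h0] at this
            have h2 := mul_le_mul_of_nonneg_left (le_abs_self (semicirclePrimitive N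
              (u (.inl b) x ^ 2) - semicirclePrimitive N (φ (v 0) ^ 2))) (Real.sqrt_nonneg 3)
            linarith
          · linarith [h.2, hy.1]
        · refine ⟨x, G.len b, hx0.le, hxl.le, le_rfl, fun N hN => ?_, volume_Icc_diff_ne_zero
            ⟨0, x, hx0, fun y hy => ⟨⟨hy.1.le, by linarith [hy.2]⟩, fun h => ?_⟩⟩⟩
          · have := (hu.1 (.inl b)).abs_semicirclePrimitive_sub_le (G.isEdgeInterval_interval _)
              hx hlI hxl.le (hN _)
            rw [hφ _ _ _ (.tgt b), ← h0, abs_sub_comm] at this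
            have h2 := mul_le_mul_of_nonneg_left (le_abs_self (semicirclePrimitive N
              (u (.inl b) x ^ 2) - semicirclePrimitive N (φ (v 0) ^ 2))) (Real.sqrt_nonneg 3)
            linarith
          · linarith [h.1, hy.2]
      have hsub : Icc c d ⊆ G.interval (.inl b) := Icc_subset_Icc hc0 hd
      let J : B → Set ℝ := Function.update (fun _ => ∅) b (Icc c d)
      have hJ : ∀ b', MeasurableSet (J b') ∧ J b' ⊆ G.interval (.inl b') := by
        intro b'
        by_cases hE : b' = b
        · subst hE
          simpa [J] using hsub
        · simp [J, hE]
      refine ⟨G.pathSet (Finset.univ.image p) h₀ J, measurableSet_pathSet _ _ fun b => (hJ b).1,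
        pathSet_subset _ _ fun b => (hJ b).2, fun N hN => ?_, fun hvol => ?_⟩
      · refine le_trans ?_ (hc.add_sum_compl_le hn hu hφ hN J)
        refine (hbound N hN).trans (add_le_add le_rfl ?_)
        have := Finset.single_le_sum (f := fun b' => ∫ x in J b', shiftedDensity N (u (.inl b')) x)
          (fun b' _ => setIntegral_shiftedDensity_nonneg (hJ b').1 (hJ b').2 (hN _)) hbmem
        simpa [J] using this
      · exfalso
        have h1 := hvol (.inl b)
        rw [pathSet, Sum.elim_inl, if_neg (by simpa using hb)] at h1
        simp only [J, Function.update_self] at h1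
        exact hne h1

end MetricGraph

namespace MetricGraph

variable {V B H : Type*} {G : MetricGraph V B H} {u : B ⊕ H → ℝ → ℝ}

/-! ### Sharp inequalities on connected non-compact graphs -/

theorem MemH1.const_mul (hu : G.MemH1 u) (c : ℝ) : G.MemH1 fun e x => c * u e x := by
  obtain ⟨φ, hφ⟩ := hu.2
  exact ⟨fun e => (hu.1 e).const_mul c, fun v => c * φ v, fun e x v h =>
    congrArg (c * ·) (hφ e x v h)⟩

variable [Fintype B] [Fintype H]

theorem integralPow_two_eq (G : MetricGraph V B H) (u : B ⊕ H → ℝ → ℝ) :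
    G.integralPow 2 u = ∑ e, ∫ x in G.interval e, u e x ^ 2 := by
  simp [integralPow]

theorem integralPow_six_eq (G : MetricGraph V B H) (u : B ⊕ H → ℝ → ℝ) :
    G.integralPow 6 u = ∑ e, ∫ x in G.interval e, u e x ^ 6 := by
  have : ∀ x : ℝ, |x| ^ 6 = x ^ 6 := fun x => Even.pow_abs (by decide) x
  simp [integralPow, this]

theorem kinetic_eq (G : MetricGraph V B H) (u : B ⊕ H → ℝ → ℝ) :
    G.kinetic u = ∑ e, ∫ x in G.interval e, deriv (u e) x ^ 2 := by
  simp [kinetic]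

theorem integralPow_nonneg {𝕜 : Type*} [RCLike 𝕜] (G : MetricGraph V B H) (p : ℕ)
    (u : B ⊕ H → ℝ → 𝕜) : 0 ≤ G.integralPow p u :=
  Finset.sum_nonneg fun _ _ => integral_nonneg fun _ => by positivity

theorem kinetic_nonneg {𝕜 : Type*} [RCLike 𝕜] (G : MetricGraph V B H)
    (u : B ⊕ H → ℝ → 𝕜) : 0 ≤ G.kinetic u :=
  Finset.sum_nonneg fun _ _ => integral_nonneg fun _ => by positivity

theorem integralPow_two_const_mul (G : MetricGraph V B H) (u : B ⊕ H → ℝ → ℝ) (c : ℝ) :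
    G.integralPow 2 (fun e x => c * u e x) = c ^ 2 * G.integralPow 2 u := by
  simp_rw [integralPow_two_eq, Finset.mul_sum, ← integral_const_mul, mul_pow]

theorem integralPow_six_const_mul (G : MetricGraph V B H) (u : B ⊕ H → ℝ → ℝ) (c : ℝ) :
    G.integralPow 6 (fun e x => c * u e x) = c ^ 6 * G.integralPow 6 u := by
  simp_rw [integralPow_six_eq, Finset.mul_sum, ← integral_const_mul, mul_pow]

theorem kinetic_const_mul (G : MetricGraph V B H) (u : B ⊕ H → ℝ → ℝ) (c : ℝ) :
    G.kinetic (fun e x => c * u e x) = c ^ 2 * G.kinetic u := by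
  simp_rw [kinetic_eq, Finset.mul_sum, ← integral_const_mul]
  refine Finset.sum_congr rfl fun e _ => integral_congr_ae (.of_forall fun x => ?_)
  simp only
  rw [deriv_const_mul_field, mul_pow]

theorem MemH1Interval.integral_shiftedDensity {I : Set ℝ} {u : ℝ → ℝ} (hu : MemH1Interval I u)
    (hI : IsEdgeInterval I) (N : ℝ) : ∫ x in I, shiftedDensity N u x =
      3 * (∫ x in I, deriv u x ^ 2) - (∫ x in I, u x ^ 6) + N ^ 2 * ∫ x in I, u x ^ 2 := by
  unfold shiftedDensity
  rw [integral_add, integral_sub, integral_const_mul, integral_const_mul]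
  · exact hu.integrableOn_deriv_sq.const_mul 3
  · exact hu.integrableOn_pow_six hI
  · exact (hu.integrableOn_deriv_sq.const_mul 3).sub (hu.integrableOn_pow_six hI)
  · exact hu.integrableOn_sq.const_mul _

theorem MemH1.sum_integral_shiftedDensity (hu : G.MemH1 u) (N : ℝ) :
    ∑ e, ∫ x in G.interval e, shiftedDensity N (u e) x =
      3 * G.kinetic u - G.integralPow 6 u + N ^ 2 * G.integralPow 2 u := by
  rw [integralPow_two_eq, integralPow_six_eq, kinetic_eq, Finset.mul_sum, Finset.mul_sum,
    ← Finset.sum_sub_distrib, ← Finset.sum_add_distrib]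
  exact Finset.sum_congr rfl fun e _ =>
    (hu.1 e).integral_shiftedDensity (G.isEdgeInterval_interval e) N

theorem MemH1.integralPow_six_le (hu : G.MemH1 u) {S : ℝ}
    (hS : ∀ e, ∀ y ∈ G.interval e, u e y ^ 2 ≤ S) :
    G.integralPow 6 u ≤ S ^ 2 * G.integralPow 2 u := by
  rw [integralPow_two_eq, integralPow_six_eq, Finset.mul_sum]
  refine Finset.sum_le_sum fun e _ => ?_
  rw [← integral_const_mul]
  refine setIntegral_mono_on ((hu.1 e).integrableOn_pow_six (G.isEdgeInterval_interval e))
    ((hu.1 e).integrableOn_sq.const_mul _) (G.isEdgeInterval_interval e).measurableSet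
    fun x hx => ?_
  have h1 : (u e x ^ 2) ^ 2 ≤ S ^ 2 := pow_le_pow_left₀ (sq_nonneg _) (hS e x hx) 2
  nlinarith [sq_nonneg (u e x)]

/-- The critical mass of the half-line. -/
noncomputable def halfLineMass : ℝ := √3 * Real.pi / 4

theorem halfLineMass_pos : 0 < halfLineMass := by
  unfold halfLineMass
  positivity

theorem halfLineMass_sq : halfLineMass ^ 2 = 3 * Real.pi ^ 2 / 16 := by
  unfold halfLineMass
  rw [div_pow, mul_pow, Real.sq_sqrt (by norm_num)]
  norm_num

/-- Escape from a maximum point with `N = S`: the calibration gives the full quarter disc, and off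
`T` the density is nonnegative. -/
theorem MemH1.halfLineMass_le (hconn : G.IsConnected) (hH : Nonempty H) (hu : G.MemH1 u) {S : ℝ}
    (hS : ∀ e, ∀ y ∈ G.interval e, u e y ^ 2 ≤ S)
    (hS' : ∃ e, ∃ x ∈ G.interval e, u e x ^ 2 = S) :
    S ^ 2 * halfLineMass ≤ 3 * G.kinetic u - G.integralPow 6 u + S ^ 2 * G.integralPow 2 u := by
  obtain ⟨e, x, hx, hxS⟩ := hS'
  obtain ⟨T, hTm, hT, hbound, -⟩ := hu.exists_escape hconn hH hx
  have hS0 : 0 ≤ S := hxS ▸ sq_nonneg _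
  have h := hbound S hS
  rw [hxS, semicirclePrimitive_self hS0] at h
  rw [← hu.sum_integral_shiftedDensity]
  calc S ^ 2 * halfLineMass = √3 * (Real.pi * S ^ 2 / 4) := by unfold halfLineMass; ring
    _ ≤ _ := h
    _ ≤ _ := Finset.sum_le_sum fun E _ => ?_
  have hI := G.isEdgeInterval_interval E
  refine setIntegral_mono_set ((hu.1 E).integrableOn_shiftedDensity hI S) ?_ (hT E).eventuallyLE
  exact (ae_restrict_mem hI.measurableSet).mono fun x hx => shiftedDensity_nonneg (hS E x hx)

/-- The Gagliardo-Nirenberg inequality on a connected non-compact graph, with the best constant of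
the half-line. -/
theorem MemH1.gagliardoNirenberg_halfLine (hconn : G.IsConnected) (hH : Nonempty H)
    (hu : G.MemH1 u) :
    G.integralPow 6 u ≤ 3 / halfLineMass ^ 2 * G.integralPow 2 u ^ 2 * G.kinetic u := by
  obtain ⟨e, x, hx, hmax⟩ := hu.exists_forall_sq_le hH
  rcases (G.integralPow_nonneg 2 u).eq_or_lt with h0 | hpos
  · have := hu.integralPow_six_le hmax
    rw [← h0] at this ⊢
    simpa using this
  -- Both sides are homogeneous of degree six, so the mass may be normalised to `halfLineMass`; the
  -- terms in `S ^ 2` then cancel.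
  · set c := √(halfLineMass / G.integralPow 2 u) with hc
    have hc2 : c ^ 2 = halfLineMass / G.integralPow 2 u :=
      Real.sq_sqrt (div_nonneg halfLineMass_pos.le hpos.le)
    have hc0 : 0 < c ^ 2 := by
      rw [hc2]
      exact div_pos halfLineMass_pos hpos
    have h := (hu.const_mul c).halfLineMass_le hconn hH (S := c ^ 2 * u e x ^ 2)
      (fun e' y hy => by
        rw [mul_pow]
        exact mul_le_mul_of_nonneg_left (hmax e' y hy) (sq_nonneg c))
      ⟨e, x, hx, by rw [mul_pow]⟩
    rw [integralPow_two_const_mul, integralPow_six_const_mul, kinetic_const_mul] at h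
    have h1 : c ^ 2 * G.integralPow 2 u = halfLineMass := by
      rw [hc2]
      field_simp
    rw [h1] at h
    have h2 : c ^ 2 * (c ^ 4 * G.integralPow 6 u) ≤ c ^ 2 * (3 * G.kinetic u) := by
      nlinarith
    have h3 := le_of_mul_le_mul_left h2 hc0
    have h4 : c ^ 4 = halfLineMass ^ 2 / G.integralPow 2 u ^ 2 := by
      rw [← div_pow, ← hc2]
      ring
    rw [h4] at h3
    have hm := halfLineMass_pos
    rw [div_mul_eq_mul_div, div_le_iff₀ (by positivity)] at h3
    rw [div_mul_eq_mul_div, div_mul_eq_mul_div, le_div_iff₀ (by positivity)]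
    linarith

/-- A function of negative energy on a half-line has a mass larger than the critical mass of the
half-line. -/
theorem MemH1Interval.halfLineMass_lt {u : ℝ → ℝ} (hu : MemH1Interval (Ici 0) u)
    (hneg : 3 * (∫ x in Ici 0, deriv u x ^ 2) < ∫ x in Ici 0, u x ^ 6) :
    halfLineMass < ∫ x in Ici 0, u x ^ 2 := by
  have hI : IsEdgeInterval (Ici 0) := Or.inr rfl
  obtain ⟨x, hx, hmax⟩ := hu.exists_forall_sq_le hI
  have hx0 : (0 : ℝ) ≤ x := hx
  set S := u x ^ 2 with hS
  have h1 := hu.semicirclePrimitive_le hx hmax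
  have h2 : ∫ y in Ici x, shiftedDensity S u y ≤ ∫ y in Ici 0, shiftedDensity S u y := by
    refine setIntegral_mono_set (hu.integrableOn_shiftedDensity hI S) ?_
      (Ici_subset_Ici.2 hx0).eventuallyLE
    exact (ae_restrict_mem hI.measurableSet).mono fun y hy => shiftedDensity_nonneg (hmax y hy)
  rw [← hS, semicirclePrimitive_self (sq_nonneg _)] at h1
  rw [hu.integral_shiftedDensity hI] at h2
  have h3 : √3 * (Real.pi * S ^ 2 / 4) = S ^ 2 * halfLineMass := by unfold halfLineMass; ring
  by_contra hle
  have := mul_le_mul_of_nonneg_left (not_lt.1 hle) (sq_nonneg S)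
  linarith

/-- If the critical mass of the half-line carries a nowhere vanishing function of energy zero, then
the graph is isometric to the half-line. -/
theorem MemH1.isometricToHalfLine (hconn : G.IsConnected) (hH : Nonempty H) (hu : G.MemH1 u)
    (hne : ∀ e, ∀ x ∈ G.interval e, u e x ≠ 0) (hE : 3 * G.kinetic u = G.integralPow 6 u)
    (hm : G.integralPow 2 u = halfLineMass) : G.IsometricToHalfLine := by
  obtain ⟨e, x, hx, hmax⟩ := hu.exists_forall_sq_le hH
  set S := u e x ^ 2 with hS
  have hS0 : 0 < S := by
    have := hne e x hx
    positivity
  obtain ⟨T, hTm, hT, hbound, hiso⟩ := hu.exists_escape hconn hH hx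
  refine hiso fun E₀ => ?_
  have hIm : ∀ E, MeasurableSet (G.interval E) := fun E =>
    (G.isEdgeInterval_interval E).measurableSet
  set off := ∑ E, ∫ y in G.interval E \ T E, u E y ^ 2 with hoff
  -- Use `N = S + t`. The part off `T` contributes at least `t (2S + t) off`, while the primitive at
  -- `S` misses the quarter disc by at most `t √(2(S + t)t)`. Zero energy and mass `halfLineMass`
  -- cancel the main terms, and `t` divides out.
  have hkey : ∀ t : ℝ, 0 < t → (2 * S + t) * off ≤ √3 * √(2 * (S + t) * t) := by
    intro t ht
    have h1 := hbound (S + t) fun E y hy => (hmax E y hy).trans (by linarith)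
    have h2 := le_semicirclePrimitive hS0.le (by linarith : S ≤ S + t)
    have h3 : (∑ E, ∫ y in T E, shiftedDensity (S + t) (u E) y) +
        ∑ E, ∫ y in G.interval E \ T E, shiftedDensity (S + t) (u E) y =
        ∑ E, ∫ y in G.interval E, shiftedDensity (S + t) (u E) y := by
      rw [← Finset.sum_add_distrib]
      refine Finset.sum_congr rfl fun E _ => ?_
      have hint := (hu.1 E).integrableOn_shiftedDensity (G.isEdgeInterval_interval E) (S + t)
      rw [setIntegral_sdiff (hTm E) hint (hT E)]
      ring
    have h4 : ((S + t) ^ 2 - S ^ 2) * off ≤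
        ∑ E, ∫ y in G.interval E \ T E, shiftedDensity (S + t) (u E) y := by
      rw [hoff, Finset.mul_sum]
      refine Finset.sum_le_sum fun E _ => ?_
      rw [← integral_const_mul]
      refine setIntegral_mono_on (((hu.1 E).integrableOn_sq.mono_set sdiff_subset).const_mul _)
        (((hu.1 E).integrableOn_shiftedDensity (G.isEdgeInterval_interval E) _).mono_set
          sdiff_subset) ((hIm E).diff (hTm E)) fun y hy => ?_
      exact mul_sq_le_shiftedDensity (hmax E y hy.1)
    rw [hu.sum_integral_shiftedDensity, hE, hm] at h3
    rw [← hS] at h1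
    have h5 := mul_le_mul_of_nonneg_left h2 (Real.sqrt_nonneg 3)
    have h6 : (S + t) ^ 2 * halfLineMass = √3 * (Real.pi * (S + t) ^ 2 / 4) := by
      unfold halfLineMass; ring
    have h7 : S + t - S = t := by ring
    rw [h7] at h5
    have h8 : t * ((2 * S + t) * off) ≤ t * (√3 * √(2 * (S + t) * t)) := by
      nlinarith
    exact le_of_mul_le_mul_left h8 ht
  -- As `t → 0` only `2S · off ≤ 0` remains.
  have hoff0 : off ≤ 0 := by
    have hc1 : Filter.Tendsto (fun t : ℝ => (2 * S + t) * off) (nhdsWithin 0 (Ioi 0))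
        (nhds ((2 * S + 0) * off)) := by
      refine (Continuous.tendsto ?_ 0).mono_left nhdsWithin_le_nhds
      fun_prop
    have hc2 : Filter.Tendsto (fun t : ℝ => √3 * √(2 * (S + t) * t)) (nhdsWithin 0 (Ioi 0))
        (nhds (√3 * √(2 * (S + 0) * 0))) := by
      refine (Continuous.tendsto (f := fun t : ℝ => √3 * √(2 * (S + t) * t)) ?_ 0).mono_left
        nhdsWithin_le_nhds
      fun_prop
    have := le_of_tendsto_of_tendsto hc1 hc2 (eventually_mem_nhdsWithin.mono fun t ht => hkey t ht)
    simp at this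
    nlinarith
  have hnn : ∀ E, 0 ≤ ∫ y in G.interval E \ T E, u E y ^ 2 := fun E =>
    integral_nonneg fun y => sq_nonneg _
  have hzero : ∫ y in G.interval E₀ \ T E₀, u E₀ y ^ 2 ≤ 0 :=
    (Finset.single_le_sum (fun E _ => hnn E) (Finset.mem_univ E₀)).trans hoff0
  by_contra hvol
  have hsupp : Function.support (fun y => u E₀ y ^ 2) ∩ (G.interval E₀ \ T E₀) =
      G.interval E₀ \ T E₀ := by
    refine inter_eq_right.2 fun y hy => ?_
    exact pow_ne_zero 2 (hne E₀ y hy.1)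
  have hpos := (setIntegral_pos_iff_support_of_nonneg_ae
    (.of_forall fun y => sq_nonneg (u E₀ y)) ((hu.1 E₀).integrableOn_sq.mono_set
      (sdiff_subset (t := T E₀)))).2 (by rw [hsupp]; exact pos_iff_ne_zero.2 hvol)
  linarith

end MetricGraph

namespace MetricGraph

/-! ### Solitons -/

theorem tendsto_sinh_atTop : Filter.Tendsto Real.sinh Filter.atTop Filter.atTop :=
  Real.sinhOrderIso.tendsto_atTop

theorem tendsto_cosh_atTop : Filter.Tendsto Real.cosh Filter.atTop Filter.atTop :=
  Filter.tendsto_atTop_mono (fun x => (Real.sinh_lt_cosh x).le) tendsto_sinh_atTop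

theorem tendsto_arctan_sinh_atTop :
    Filter.Tendsto (fun x => Real.arctan (Real.sinh x)) Filter.atTop (nhds (Real.pi / 2)) :=
  (Real.tendsto_arctan_atTop.mono_right nhdsWithin_le_nhds).comp tendsto_sinh_atTop

theorem tendsto_sinh_div_cosh_sq_atTop :
    Filter.Tendsto (fun x => Real.sinh x / Real.cosh x ^ 2) Filter.atTop (nhds 0) := by
  refine squeeze_zero_norm' ?_ tendsto_cosh_atTop.inv_tendsto_atTop
  filter_upwards [Filter.eventually_ge_atTop 0] with x hx
  have h1 := Real.cosh_pos x
  rw [Real.norm_of_nonneg (div_nonneg (Real.sinh_nonneg_iff.2 hx) (sq_nonneg _)), Pi.inv_apply,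
    div_le_iff₀ (by positivity)]
  have : (Real.cosh x)⁻¹ * Real.cosh x ^ 2 = Real.cosh x := by field_simp
  rw [this]
  exact (Real.sinh_lt_cosh x).le

theorem hasDerivAt_arctan_sinh (x : ℝ) :
    HasDerivAt (fun x => Real.arctan (Real.sinh x)) (1 / Real.cosh x) x := by
  convert (Real.hasDerivAt_sinh x).arctan using 1
  have h1 := Real.cosh_pos x
  rw [add_comm 1, ← Real.cosh_sq]
  field_simp

/-- Together with `arctan ∘ sinh` this provides primitives of `1 / cosh` and `1 / cosh ^ 3`, the
only integrands produced by solitons. -/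
theorem hasDerivAt_sinh_div_cosh_sq (x : ℝ) :
    HasDerivAt (fun x => Real.sinh x / Real.cosh x ^ 2)
      (2 / Real.cosh x ^ 3 - 1 / Real.cosh x) x := by
  have h1 := Real.cosh_pos x
  refine ((Real.hasDerivAt_sinh x).fun_div ((Real.hasDerivAt_cosh x).fun_pow 2)
    (by positivity)).congr_deriv ?_
  field_simp
  linear_combination (-2 * Real.cosh x) * Real.sinh_sq x

/-- The soliton of width `1 / ε` centred at `-c / ε`. -/
noncomputable def soliton (ε c x : ℝ) : ℝ := √(ε / Real.cosh (ε * x + c))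

theorem soliton_sq {ε : ℝ} (hε : 0 < ε) (c x : ℝ) :
    soliton ε c x ^ 2 = ε / Real.cosh (ε * x + c) :=
  Real.sq_sqrt (div_nonneg hε.le (Real.cosh_pos _).le)

theorem deriv_soliton_sq {ε : ℝ} (hε : 0 < ε) (c x : ℝ) :
    deriv (soliton ε c) x ^ 2 =
      ε ^ 3 / 4 * (1 / Real.cosh (ε * x + c) - 1 / Real.cosh (ε * x + c) ^ 3) := by
  have hc := Real.cosh_pos (ε * x + c)
  have h0 : HasDerivAt (fun x => ε * x + c) ε x := by
    simpa using ((hasDerivAt_id x).const_mul ε).add_const c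
  have h1 : HasDerivAt (fun x => ε / Real.cosh (ε * x + c))
      (-(ε ^ 2 * Real.sinh (ε * x + c)) / Real.cosh (ε * x + c) ^ 2) x := by
    refine ((hasDerivAt_const x ε).fun_div h0.cosh hc.ne').congr_deriv ?_
    ring
  have h2 := h1.sqrt (div_pos hε hc).ne'
  have h3 : deriv (soliton ε c) x = _ := h2.deriv
  rw [h3, div_pow, mul_pow, Real.sq_sqrt (div_pos hε hc).le, div_pow, neg_sq, mul_pow,
    Real.sinh_sq]
  field_simp
  ring

/-- Nonnegativity of the derivative turns the existence of a limit at infinity into integrability.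
-/
theorem integral_comp_affine {ε : ℝ} (hε : 0 < ε) (c : ℝ) {g g' : ℝ → ℝ} {l : ℝ}
    (hg : ∀ x, HasDerivAt g (g' x) x) (hnn : ∀ x, 0 ≤ g' x)
    (hl : Filter.Tendsto g Filter.atTop (nhds l)) :
    IntegrableOn (fun x => ε * g' (ε * x + c)) (Ici 0) ∧
      ∫ x in Ici 0, ε * g' (ε * x + c) = l - g c := by
  have h0 : ∀ x, HasDerivAt (fun x => ε * x + c) ε x := fun x => by
    simpa using ((hasDerivAt_id x).const_mul ε).add_const c
  have h1 : ∀ x ∈ Ici (0 : ℝ), HasDerivAt (fun x => g (ε * x + c)) (ε * g' (ε * x + c)) x :=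
    fun x _ => by
      rw [mul_comm]
      exact (hg (ε * x + c)).comp x (h0 x)
  have h2 : ∀ x ∈ Ioi (0 : ℝ), 0 ≤ ε * g' (ε * x + c) := fun x _ => mul_nonneg hε.le (hnn _)
  have h3 : Filter.Tendsto (fun x => g (ε * x + c)) Filter.atTop (nhds l) :=
    hl.comp (Filter.tendsto_atTop_add_const_right _ _ (Filter.tendsto_id.const_mul_atTop hε))
  refine ⟨?_, ?_⟩
  · rw [integrableOn_Ici_iff_integrableOn_Ioi]
    exact integrableOn_Ioi_deriv_of_nonneg' h1 h2 h3
  · rw [integral_Ici_eq_integral_Ioi, integral_Ioi_of_hasDerivAt_of_nonneg' h1 h2 h3]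
    simp

theorem integral_soliton_sq {ε : ℝ} (hε : 0 < ε) (c : ℝ) :
    IntegrableOn (fun x => soliton ε c x ^ 2) (Ici 0) ∧
      ∫ x in Ici 0, soliton ε c x ^ 2 = Real.pi / 2 - Real.arctan (Real.sinh c) := by
  have h := integral_comp_affine hε c hasDerivAt_arctan_sinh
    (fun x => (one_div_pos.2 (Real.cosh_pos x)).le) tendsto_arctan_sinh_atTop
  simp only [mul_one_div] at h
  simp_rw [soliton_sq hε]
  exact h

theorem integral_soliton_pow_six {ε : ℝ} (hε : 0 < ε) (c : ℝ) :
    ∫ x in Ici 0, soliton ε c x ^ 6 = ε ^ 2 / 2 *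
      (Real.pi / 2 - Real.arctan (Real.sinh c) - Real.sinh c / Real.cosh c ^ 2) := by
  have h := (integral_comp_affine hε c
    (g := fun x => ε ^ 2 / 2 * (Real.arctan (Real.sinh x) + Real.sinh x / Real.cosh x ^ 2))
    (g' := fun x => ε ^ 2 / 2 * (1 / Real.cosh x + (2 / Real.cosh x ^ 3 - 1 / Real.cosh x)))
    (fun x => ((hasDerivAt_arctan_sinh x).add (hasDerivAt_sinh_div_cosh_sq x)).const_mul _)
    (fun x => by
      have := Real.cosh_pos x
      rw [add_sub_cancel]
      positivity)
    ((tendsto_arctan_sinh_atTop.add tendsto_sinh_div_cosh_sq_atTop).const_mul _)).2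
  have h6 : ∀ x, soliton ε c x ^ 6 = ε * (ε ^ 2 / 2 * (1 / Real.cosh (ε * x + c) +
      (2 / Real.cosh (ε * x + c) ^ 3 - 1 / Real.cosh (ε * x + c)))) := fun x => by
    have := Real.cosh_pos (ε * x + c)
    rw [show soliton ε c x ^ 6 = (soliton ε c x ^ 2) ^ 3 by ring, soliton_sq hε]
    field_simp
    ring
  simp_rw [h6]
  rw [h]
  ring

theorem integral_deriv_soliton_sq {ε : ℝ} (hε : 0 < ε) (c : ℝ) :
    IntegrableOn (fun x => deriv (soliton ε c) x ^ 2) (Ici 0) ∧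
      ∫ x in Ici 0, deriv (soliton ε c) x ^ 2 = ε ^ 2 / 8 *
        (Real.pi / 2 - Real.arctan (Real.sinh c) + Real.sinh c / Real.cosh c ^ 2) := by
  have h := integral_comp_affine hε c
    (g := fun x => ε ^ 2 / 8 * (Real.arctan (Real.sinh x) - Real.sinh x / Real.cosh x ^ 2))
    (g' := fun x => ε ^ 2 / 8 * (1 / Real.cosh x - (2 / Real.cosh x ^ 3 - 1 / Real.cosh x)))
    (fun x => ((hasDerivAt_arctan_sinh x).sub (hasDerivAt_sinh_div_cosh_sq x)).const_mul _)
    (fun x => by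
      have h1 := Real.one_le_cosh x
      have h2 : 1 / Real.cosh x ^ 3 ≤ 1 / Real.cosh x := by
        apply one_div_le_one_div_of_le (by positivity)
        nlinarith [sq_nonneg (Real.cosh x)]
      have h3 : 2 / Real.cosh x ^ 3 = 2 * (1 / Real.cosh x ^ 3) := by ring
      rw [h3]
      refine mul_nonneg (by positivity) ?_
      linarith)
    ((tendsto_arctan_sinh_atTop.sub tendsto_sinh_div_cosh_sq_atTop).const_mul _)
  have h6 : ∀ x, deriv (soliton ε c) x ^ 2 = ε * (ε ^ 2 / 8 * (1 / Real.cosh (ε * x + c) -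
      (2 / Real.cosh (ε * x + c) ^ 3 - 1 / Real.cosh (ε * x + c)))) := fun x => by
    rw [deriv_soliton_sq hε]
    ring
  simp_rw [h6]
  refine ⟨h.1, ?_⟩
  rw [h.2]
  ring

theorem contDiff_soliton {ε : ℝ} (hε : 0 < ε) (c : ℝ) : ContDiff ℝ 1 (soliton ε c) := by
  have hpos : ∀ x, Real.cosh (ε * x + c) ≠ 0 := fun x => (Real.cosh_pos _).ne'
  have : ContDiff ℝ 1 fun x => ε / Real.cosh (ε * x + c) :=
    contDiff_const.div (Real.contDiff_cosh.comp (by fun_prop)) hpos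
  exact this.sqrt fun x => (div_pos hε (Real.cosh_pos _)).ne'

theorem memH1Interval_soliton {ε : ℝ} (hε : 0 < ε) (c : ℝ) :
    MemH1Interval (Ici 0) (soliton ε c) := by
  have h := contDiff_soliton hε c
  refine ⟨fun a _ b _ => h.contDiffOn.absolutelyContinuousOnInterval, ?_, ?_⟩
  · exact (memLp_two_iff_integrable_sq h.continuous.aestronglyMeasurable).2
      (integral_soliton_sq hε c).1
  · exact (memLp_two_iff_integrable_sq (measurable_deriv _).aestronglyMeasurable).2
      (integral_deriv_soliton_sq hε c).1

theorem memH1Interval_const (L a : ℝ) : MemH1Interval (Icc 0 L) fun _ : ℝ => a := by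
  refine ⟨fun a _ b _ => contDiffOn_const.absolutelyContinuousOnInterval, memLp_const a, ?_⟩
  simp

variable {V B H : Type*} [Fintype B] [Fintype H] {G : MetricGraph V B H}

/-- A soliton of width `1 / ε` centred at distance `R / ε` from the vertex of one half-line,
extended by a constant to the bounded edges and by its tail to the other half-lines. -/
theorem exists_soliton_like (G : MetricGraph V B H) (hH : Nonempty H) {ε : ℝ} (hε : 0 < ε) (R : ℝ) :
    ∃ w : B ⊕ H → ℝ → ℝ, G.MemH1 w ∧
      G.integralPow 2 w = (Real.pi / 2 + Real.arctan (Real.sinh R)) +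
        (Fintype.card H - 1) * (Real.pi / 2 - Real.arctan (Real.sinh R)) +
        ε / Real.cosh R * ∑ b, G.len b ∧
      G.kinetic w = ε ^ 2 / 8 *
        ((Real.pi / 2 + Real.arctan (Real.sinh R) - Real.sinh R / Real.cosh R ^ 2) +
          (Fintype.card H - 1) *
            (Real.pi / 2 - Real.arctan (Real.sinh R) + Real.sinh R / Real.cosh R ^ 2)) ∧
      ε ^ 2 / 2 * (Real.pi / 2 + Real.arctan (Real.sinh R) + Real.sinh R / Real.cosh R ^ 2) ≤
        G.integralPow 6 w := by
  classical
  obtain ⟨h₀⟩ := hH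
  -- The soliton peaks on `h₀` and the other half-lines carry its tail; as `cosh` is even, all of
  -- them take the same value at the root, which makes the constant extension continuous.
  let c : H → ℝ := fun h => if h = h₀ then -R else R
  have hcosh : ∀ h, Real.cosh (c h) = Real.cosh R := fun h => by
    simp only [c]
    split_ifs <;> simp
  have hsum : ∀ f : ℝ → ℝ, ∑ h, f (c h) = f (-R) + (Fintype.card H - 1) * f R := fun f => by
    rw [← Finset.add_sum_erase _ _ (Finset.mem_univ h₀),
      Finset.sum_congr rfl (g := fun _ => f R) fun h hh => by simp [c, Finset.ne_of_mem_erase hh]]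
    have : 1 ≤ Fintype.card H := Fintype.card_pos_iff.2 ⟨h₀⟩
    simp [c, Finset.card_erase_of_mem, Nat.cast_sub this]
  have hI : ∀ h : H, G.interval (.inr h) = Ici 0 := fun _ => rfl
  refine ⟨Sum.elim (fun _ _ => √(ε / Real.cosh R)) fun h => soliton ε (c h), ⟨?_, ?_⟩, ?_, ?_, ?_⟩
  · rintro (b | h)
    · exact memH1Interval_const _ _
    · exact memH1Interval_soliton hε _
  · refine ⟨fun _ => √(ε / Real.cosh R), ?_⟩
    rintro _ _ _ (b | b | h)
    · rfl
    · rfl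
    · simp [soliton, hcosh]
  · rw [integralPow_two_eq, Fintype.sum_sum_type, add_comm]
    congr 1
    · simp only [Sum.elim_inr, hI, (integral_soliton_sq hε _).2]
      rw [hsum fun c => Real.pi / 2 - Real.arctan (Real.sinh c)]
      simp
    · simp only [Sum.elim_inl, Real.sq_sqrt (div_pos hε (Real.cosh_pos R)).le, Finset.mul_sum]
      refine Finset.sum_congr rfl fun b _ => ?_
      simp [interval, (G.len_pos b).le, mul_comm]
  · rw [kinetic_eq, Fintype.sum_sum_type]
    simp only [Sum.elim_inr, Sum.elim_inl, hI, (integral_deriv_soliton_sq hε _).2]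
    rw [← Finset.mul_sum,
      hsum fun c => Real.pi / 2 - Real.arctan (Real.sinh c) + Real.sinh c / Real.cosh c ^ 2]
    simp
    left
    ring
  · rw [integralPow_six_eq]
    refine le_trans (le_of_eq ?_) (Finset.single_le_sum (fun e _ => ?_) (Finset.mem_univ (.inr h₀)))
    · simp only [Sum.elim_inr, hI, integral_soliton_pow_six hε, c, if_true]
      simp
      left
      ring
    · exact integral_nonneg fun x => Even.pow_nonneg (by decide) _

/-- The Gagliardo-Nirenberg constant of a non-compact graph is at least the one of the line. -/
theorem le_of_gagliardoNirenberg (hH : Nonempty H) {K : ℝ}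
    (hK : ∀ u : B ⊕ H → ℝ → ℝ, G.MemH1 u →
      G.integralPow 6 u ≤ K * G.integralPow 2 u ^ 2 * G.kinetic u) :
    3 / (2 * halfLineMass) ^ 2 ≤ K := by
  -- Take `ε = 1` and let `R → ∞`: the whole soliton fits into one half-line, while the mass on the
  -- bounded edges and on the other half-lines disappears.
  have h : ∀ R : ℝ, 1 ^ 2 / 2 * (Real.pi / 2 + Real.arctan (Real.sinh R) +
      Real.sinh R / Real.cosh R ^ 2) ≤
      K * ((Real.pi / 2 + Real.arctan (Real.sinh R)) +
        (Fintype.card H - 1) * (Real.pi / 2 - Real.arctan (Real.sinh R)) +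
        1 / Real.cosh R * ∑ b, G.len b) ^ 2 * (1 ^ 2 / 8 *
        ((Real.pi / 2 + Real.arctan (Real.sinh R) - Real.sinh R / Real.cosh R ^ 2) +
          (Fintype.card H - 1) *
            (Real.pi / 2 - Real.arctan (Real.sinh R) + Real.sinh R / Real.cosh R ^ 2))) :=
    fun R => by
      obtain ⟨w, hw, hm, hk, hp⟩ := G.exists_soliton_like hH one_pos R
      rw [← hm, ← hk]
      exact hp.trans (hK w hw)
  have ha := tendsto_arctan_sinh_atTop
  have hb := tendsto_sinh_div_cosh_sq_atTop
  have hc : Filter.Tendsto (fun x => 1 / Real.cosh x) Filter.atTop (nhds 0) := by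
    simp only [one_div]
    exact tendsto_cosh_atTop.inv_tendsto_atTop
  have hlim := le_of_tendsto_of_tendsto'
    (((ha.const_add (Real.pi / 2)).add hb).const_mul (1 ^ 2 / 2))
    ((((((ha.const_add (Real.pi / 2)).add ((ha.const_sub (Real.pi / 2)).const_mul
      ((Fintype.card H : ℝ) - 1))).add (hc.mul_const (∑ b, G.len b))).pow 2).const_mul K).mul
      ((((ha.const_add (Real.pi / 2)).sub hb).add (((ha.const_sub (Real.pi / 2)).add hb).const_mul
      ((Fintype.card H : ℝ) - 1))).const_mul (1 ^ 2 / 8))) h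
  simp only [sub_self, mul_zero, add_zero, zero_mul, sub_zero, add_halves] at hlim
  rw [mul_pow, halfLineMass_sq]
  have hpi := Real.pi_pos
  rw [div_le_iff₀ (by positivity)]
  have h2 : Real.pi * 4 ≤ Real.pi * (K * Real.pi ^ 2) := by linarith
  have := le_of_mul_le_mul_left h2 hpi
  linarith

/-- The Gagliardo-Nirenberg constant of a graph with exactly one half-line is at least the one of
the half-line. -/
theorem le_of_gagliardoNirenberg_of_card_eq_one (hH : Fintype.card H = 1) {K : ℝ}
    (hK : ∀ u : B ⊕ H → ℝ → ℝ, G.MemH1 u →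
      G.integralPow 6 u ≤ K * G.integralPow 2 u ^ 2 * G.kinetic u) :
    3 / halfLineMass ^ 2 ≤ K := by
  have hH' : Nonempty H := Fintype.card_pos_iff.1 (by omega)
  have hpi := Real.pi_pos
  -- A half-soliton (`R = 0`) on the only half-line; the mass on the bounded edges vanishes as `ε →
  -- 0`.
  have h : ∀ ε : ℝ, 0 < ε → 4 ≤ K * (Real.pi / 2 + ε * ∑ b, G.len b) ^ 2 := fun ε hε => by
    obtain ⟨w, hw, hm, hk, hp⟩ := G.exists_soliton_like hH' hε 0
    have h := hp.trans (hK w hw)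
    rw [hm, hk, hH] at h
    simp at h
    have h2 : ε ^ 2 * Real.pi * 4 ≤
        ε ^ 2 * Real.pi * (K * (Real.pi / 2 + ε * ∑ b, G.len b) ^ 2) := by
      linarith
    exact le_of_mul_le_mul_left h2 (by positivity)
  have hlim : Filter.Tendsto (fun ε : ℝ => K * (Real.pi / 2 + ε * ∑ b, G.len b) ^ 2)
      (nhdsWithin 0 (Ioi 0)) (nhds (K * (Real.pi / 2 + 0 * ∑ b, G.len b) ^ 2)) := by
    refine (Continuous.tendsto
      (f := fun ε : ℝ => K * (Real.pi / 2 + ε * ∑ b, G.len b) ^ 2) ?_ 0).mono_left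
      nhdsWithin_le_nhds
    fun_prop
  have := ge_of_tendsto hlim (eventually_mem_nhdsWithin.mono h)
  rw [halfLineMass_sq, div_le_iff₀ (by positivity)]
  linarith

/-- Spreading a function along a half-line makes its energy arbitrarily small. -/
theorem exists_energy_le (G : MetricGraph V B H) (hH : Nonempty H) {μ δ : ℝ} (hμ : 0 < μ)
    (hδ : 0 < δ) : ∃ w : B ⊕ H → ℝ → ℝ, G.MemH1 w ∧ G.integralPow 2 w = μ ∧ G.energy w ≤ δ := by
  have hpi := Real.pi_pos
  set C := Real.pi / 16 * Fintype.card H with hC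
  have hC0 : 0 < C := by
    have : 0 < Fintype.card H := Fintype.card_pos_iff.2 hH
    positivity
  -- The test function has kinetic energy `ε^2 C` and mass at least `π / 2`. Rescaled to mass `μ`,
  -- its kinetic energy is at most `(2μ / π) ε^2 C`, which this choice makes equal to `2δ`.
  set ε := √(δ * Real.pi / (μ * C)) with hε
  have hε2 : ε ^ 2 = δ * Real.pi / (μ * C) := Real.sq_sqrt (by positivity)
  have hε0 : 0 < ε := Real.sqrt_pos.2 (by positivity)
  obtain ⟨w, hw, hm, hk, -⟩ := G.exists_soliton_like hH hε0 0
  have hk' : G.kinetic w = ε ^ 2 * C := by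
    rw [hk, hC]
    simp
    ring
  have hm' : Real.pi / 2 ≤ G.integralPow 2 w := by
    rw [hm]
    have h1 : (1 : ℝ) ≤ Fintype.card H := by exact_mod_cast Fintype.card_pos_iff.2 hH
    have h2 : 0 ≤ ∑ b, G.len b := Finset.sum_nonneg fun b _ => (G.len_pos b).le
    have h3 : 0 ≤ ((Fintype.card H : ℝ) - 1) * (Real.pi / 2) :=
      mul_nonneg (by linarith) (by positivity)
    simp
    nlinarith [mul_nonneg hε0.le h2]
  have hm0 : 0 < G.integralPow 2 w := by linarith [div_pos hpi two_pos]
  set c := √(μ / G.integralPow 2 w) with hc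
  have hc2 : c ^ 2 = μ / G.integralPow 2 w := Real.sq_sqrt (by positivity)
  refine ⟨_, hw.const_mul c, ?_, ?_⟩
  · rw [integralPow_two_const_mul, hc2]
    field_simp
  · have h6 := G.integralPow_nonneg 6 fun e x => c * w e x
    have h7 : c ^ 2 ≤ μ / (Real.pi / 2) := by
      rw [hc2]
      gcongr
    rw [energy, kinetic_const_mul, hk', hε2]
    have h8 : c ^ 2 * (δ * Real.pi / (μ * C) * C) ≤
        μ / (Real.pi / 2) * (δ * Real.pi / (μ * C) * C) := by gcongr
    have h9 : μ / (Real.pi / 2) * (δ * Real.pi / (μ * C) * C) = 2 * δ := by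
      field_simp
    linarith

end MetricGraph

namespace MetricGraph

/-! ### Extremal functions do not vanish -/

/-- Cut the segment from `z` to `y` into equal pieces of length at most `t`. If no piece had exactly
one end in the zero set, vanishing would propagate from `z` to `y`. -/
theorem exists_short_step {f : ℝ → ℝ} {z y : ℝ} (hz : f z = 0) (hy : f y ≠ 0) {t : ℝ} (ht : 0 < t) :
    ∃ a ∈ uIcc z y, ∃ b ∈ uIcc z y, a < b ∧ b - a ≤ t ∧
      ((f a = 0 ∧ f b ≠ 0) ∨ (f a ≠ 0 ∧ f b = 0)) := by
  by_contra! hcon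
  have hzy : z ≠ y := fun h => hy (h ▸ hz)
  obtain ⟨n, hn⟩ := exists_nat_gt (|y - z| / t)
  have hn0 : (0 : ℝ) < n := lt_of_le_of_lt (by positivity) hn
  have hmem : ∀ k : ℕ, k ≤ n → z + k / n * (y - z) ∈ uIcc z y := fun k hk => by
    have h1 : (k : ℝ) / n ≤ 1 := (div_le_one hn0).2 (by exact_mod_cast hk)
    have h2 : (0 : ℝ) ≤ k / n := by positivity
    rw [mem_uIcc]
    rcases le_total z y with h | h
    · left
      constructor <;> nlinarith
    · right
      constructor <;> nlinarith
  have hstep : ∀ k : ℕ, k ≤ n → f (z + k / n * (y - z)) = 0 := by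
    intro k
    induction k with
    | zero => intro _; simpa using hz
    | succ k ih =>
      intro hk
      have h0 := ih (by omega)
      have m1 := hmem k (by omega)
      have m2 := hmem (k + 1) hk
      set p := z + (k : ℝ) / n * (y - z) with hp
      set q := z + ((k + 1 : ℕ) : ℝ) / n * (y - z) with hq
      have hd : q - p = (y - z) / n := by
        rw [hp, hq]
        push_cast
        ring
      have habs : |q - p| ≤ t := by
        rw [hd, abs_div, abs_of_pos hn0, div_le_iff₀ hn0, mul_comm]
        exact ((div_lt_iff₀ ht).1 hn).le
      have hne : q - p ≠ 0 := by
        rw [hd]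
        exact div_ne_zero (sub_ne_zero.2 hzy.symm) hn0.ne'
      by_contra hq0
      rcases lt_or_gt_of_ne (sub_ne_zero.1 hne) with h | h
      · exact (hcon q m2 p m1 h (by rw [abs_sub_comm] at habs; exact (le_abs_self _).trans habs)).2
          hq0 h0
      · exact hq0 ((hcon p m1 q m2 h ((le_abs_self _).trans habs)).1 h0)
  apply hy
  have := hstep n le_rfl
  rwa [div_self hn0.ne', one_mul, add_sub_cancel] at this

/-! ### Adding a positive function in polar coordinates -/

section Perturbation

variable {I : Set ℝ} {u ψ : ℝ → ℝ}

theorem hasDerivAt_sqrt_sq_add_sq {x : ℝ} (hu : DifferentiableAt ℝ u x)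
    (hψ : DifferentiableAt ℝ ψ x) (hpos : 0 < ψ x) :
    HasDerivAt (fun x => √(u x ^ 2 + ψ x ^ 2))
      ((u x * deriv u x + ψ x * deriv ψ x) / √(u x ^ 2 + ψ x ^ 2)) x := by
  have h : 0 < u x ^ 2 + ψ x ^ 2 := by positivity
  refine (((hu.hasDerivAt.fun_pow 2).fun_add (hψ.hasDerivAt.fun_pow 2)).sqrt h.ne').congr_deriv ?_
  have := Real.sqrt_pos.2 h
  field_simp
  norm_num
  ring

theorem hasDerivAt_arctan_div {x : ℝ} (hu : DifferentiableAt ℝ u x)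
    (hψ : DifferentiableAt ℝ ψ x) (hpos : 0 < ψ x) :
    HasDerivAt (fun x => Real.arctan (u x / ψ x))
      ((deriv u x * ψ x - u x * deriv ψ x) / (u x ^ 2 + ψ x ^ 2)) x := by
  refine (hu.hasDerivAt.fun_div hψ.hasDerivAt hpos.ne').arctan.congr_deriv ?_
  have h : 0 < u x ^ 2 + ψ x ^ 2 := by positivity
  have h' : 0 < 1 + (u x / ψ x) ^ 2 := by positivity
  rw [div_mul_div_comm, one_mul]
  congr 1
  field_simp
  ring

/-- The derivative of `√(u ^ 2 + ψ ^ 2)` in polar coordinates. -/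
theorem deriv_sqrt_sq_add_sq_sq {x : ℝ} (hu : DifferentiableAt ℝ u x)
    (hψ : DifferentiableAt ℝ ψ x) (hpos : 0 < ψ x) :
    deriv (fun x => √(u x ^ 2 + ψ x ^ 2)) x ^ 2 = deriv u x ^ 2 + deriv ψ x ^ 2 -
      (u x ^ 2 + ψ x ^ 2) * deriv (fun x => Real.arctan (u x / ψ x)) x ^ 2 := by
  have h : 0 < u x ^ 2 + ψ x ^ 2 := by positivity
  rw [(hasDerivAt_sqrt_sq_add_sq hu hψ hpos).deriv, (hasDerivAt_arctan_div hu hψ hpos).deriv,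
    div_pow, Real.sq_sqrt h.le]
  field_simp
  ring

theorem MemH1Interval.ae_deriv_sqrt_sq_add_sq_sq (hI : IsEdgeInterval I) (hu : MemH1Interval I u)
    (hψ : Differentiable ℝ ψ) (hpos : ∀ x, 0 < ψ x) :
    ∀ᵐ x ∂volume.restrict I, deriv (fun x => √(u x ^ 2 + ψ x ^ 2)) x ^ 2 =
      deriv u x ^ 2 + deriv ψ x ^ 2 -
        (u x ^ 2 + ψ x ^ 2) * deriv (fun x => Real.arctan (u x / ψ x)) x ^ 2 := by
  filter_upwards [hu.ae_differentiableAt hI] with x hx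
  exact deriv_sqrt_sq_add_sq_sq hx (hψ x) (hpos x)

/-- On a compact interval `u ^ 2 + ψ ^ 2` is bounded below by a positive constant, where the square
root is smooth. -/
theorem MemH1Interval.sqrt_sq_add_sq (hI : IsEdgeInterval I) (hu : MemH1Interval I u)
    (hψ : MemH1Interval I ψ) (hψ1 : ContDiff ℝ 1 ψ) (hpos : ∀ x, 0 < ψ x) :
    MemH1Interval I fun x => √(u x ^ 2 + ψ x ^ 2) := by
  have hac : ∀ a ∈ I, ∀ b ∈ I,
      AbsolutelyContinuousOnInterval (fun x => √(u x ^ 2 + ψ x ^ 2)) a b := by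
    intro a ha b hb
    have h1 := hu.1 a ha b hb
    have h2 := hψ.1 a ha b hb
    have h3 : AbsolutelyContinuousOnInterval (fun x => u x ^ 2 + ψ x ^ 2) a b := by
      simpa only [sq] using (h1.fun_mul h1).fun_add (h2.fun_mul h2)
    obtain ⟨d, hd⟩ := h3.exists_bound
    obtain ⟨x₀, -, hmin⟩ := (isCompact_uIcc (a := a) (b := b)).exists_isMinOn nonempty_uIcc
      (hψ1.continuous.pow 2).continuousOn
    refine h3.contDiff_comp (c := ψ x₀ ^ 2) (d := d) (g := fun y => √y) ?_ fun x hx => ⟨?_, ?_⟩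
    · exact contDiffOn_id.sqrt fun y hy => ((pow_pos (hpos x₀) 2).trans_le hy.1).ne'
    · have : ψ x₀ ^ 2 ≤ ψ x ^ 2 := hmin hx
      nlinarith [sq_nonneg (u x)]
    · exact (le_abs_self _).trans (hd x hx)
  have hcont : ContinuousOn (fun x => √(u x ^ 2 + ψ x ^ 2)) I :=
    (((hu.continuousOn hI).pow 2).add ((hψ.continuousOn hI).pow 2)).sqrt
  refine ⟨hac, ?_, ?_⟩
  · rw [memLp_two_iff_integrable_sq (hcont.aestronglyMeasurable hI.measurableSet)]
    refine (hu.integrableOn_sq.add hψ.integrableOn_sq).congr (.of_forall fun x => ?_)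
    simp only [Pi.add_apply]
    rw [Real.sq_sqrt (by positivity)]
  · rw [memLp_two_iff_integrable_sq (measurable_deriv _).aestronglyMeasurable]
    refine (hu.integrableOn_deriv_sq.add hψ.integrableOn_deriv_sq).mono'
      ((measurable_deriv _).pow_const 2).aestronglyMeasurable ?_
    filter_upwards [hu.ae_deriv_sqrt_sq_add_sq_sq hI (hψ1.differentiable one_ne_zero) hpos]
      with x hx
    rw [Real.norm_of_nonneg (sq_nonneg _), hx]
    simp only [Pi.add_apply]
    have : 0 ≤ (u x ^ 2 + ψ x ^ 2) * deriv (fun x => Real.arctan (u x / ψ x)) x ^ 2 := by positivity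
    linarith

theorem MemH1Interval.absolutelyContinuous_arctan_div (hu : MemH1Interval I u)
    (hψ1 : ContDiff ℝ 1 ψ) (hpos : ∀ x, 0 < ψ x) {a b : ℝ} (ha : a ∈ I) (hb : b ∈ I) :
    AbsolutelyContinuousOnInterval (fun x => Real.arctan (u x / ψ x)) a b := by
  have h1 : AbsolutelyContinuousOnInterval (fun x => u x / ψ x) a b := by
    simp only [div_eq_mul_inv]
    exact (hu.1 a ha b hb).fun_mul
      (hψ1.inv fun x => (hpos x).ne').contDiffOn.absolutelyContinuousOnInterval
  obtain ⟨d, hd⟩ := h1.exists_bound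
  exact h1.contDiff_comp (c := -d) (d := d) Real.contDiff_arctan.contDiffOn fun x hx =>
    abs_le.1 (hd x hx)

theorem MemH1Interval.integral_sqrt_sq_add_sq_sq (hu : MemH1Interval I u)
    (hψ : MemH1Interval I ψ) : ∫ x in I, √(u x ^ 2 + ψ x ^ 2) ^ 2 =
      (∫ x in I, u x ^ 2) + ∫ x in I, ψ x ^ 2 := by
  rw [← integral_add hu.integrableOn_sq hψ.integrableOn_sq]
  refine integral_congr_ae (.of_forall fun x => ?_)
  exact Real.sq_sqrt (by positivity)

theorem MemH1Interval.integral_deriv_sqrt_sq_add_sq_le (hI : IsEdgeInterval I)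
    (hu : MemH1Interval I u) (hψ : MemH1Interval I ψ) (hψ1 : ContDiff ℝ 1 ψ) (hpos : ∀ x, 0 < ψ x) :
    ∫ x in I, deriv (fun x => √(u x ^ 2 + ψ x ^ 2)) x ^ 2 ≤
      (∫ x in I, deriv u x ^ 2) + ∫ x in I, deriv ψ x ^ 2 := by
  rw [← integral_add hu.integrableOn_deriv_sq hψ.integrableOn_deriv_sq]
  refine integral_mono_ae (hu.sqrt_sq_add_sq hI hψ hψ1 hpos).integrableOn_deriv_sq
    (hu.integrableOn_deriv_sq.add hψ.integrableOn_deriv_sq) ?_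
  filter_upwards [hu.ae_deriv_sqrt_sq_add_sq_sq hI (hψ1.differentiable one_ne_zero) hpos] with x hx
  rw [hx]
  have : 0 ≤ (u x ^ 2 + ψ x ^ 2) * deriv (fun x => Real.arctan (u x / ψ x)) x ^ 2 := by positivity
  linarith

/-- A variation of the polar angle `θ` on a short interval saves much kinetic energy, by
Cauchy-Schwarz. This is used in the pointwise form `θ'^2 ≥ 2 l θ' - l^2`, with `l` the mean slope,
which needs only the integrability of `θ'`. -/
theorem MemH1Interval.integral_deriv_sqrt_sq_add_sq_le_sub (hI : IsEdgeInterval I)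
    (hu : MemH1Interval I u) (hψ : MemH1Interval I ψ) (hψ1 : ContDiff ℝ 1 ψ) (hpos : ∀ x, 0 < ψ x)
    {a b c : ℝ} (ha : a ∈ I) (hb : b ∈ I) (hab : a < b) (hc : 0 ≤ c)
    (hcψ : ∀ x ∈ Icc a b, c ≤ ψ x ^ 2) :
    ∫ x in I, deriv (fun x => √(u x ^ 2 + ψ x ^ 2)) x ^ 2 ≤
      (∫ x in I, deriv u x ^ 2) + (∫ x in I, deriv ψ x ^ 2) -
        c * (Real.arctan (u b / ψ b) - Real.arctan (u a / ψ a)) ^ 2 / (b - a) := by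
  set θ := fun x => Real.arctan (u x / ψ x) with hθ
  have hac := hu.absolutelyContinuous_arctan_div hψ1 hpos ha hb
  set l := (θ b - θ a) / (b - a) with hl
  have hba : 0 < b - a := sub_pos.2 hab
  have hθi : IntegrableOn (deriv θ) (Ioc a b) :=
    (intervalIntegrable_iff_integrableOn_Ioc_of_le hab.le).1 hac.intervalIntegrable_deriv
  set g : ℝ → ℝ := fun x => c * (2 * l * deriv θ x - l ^ 2) with hg
  have hgi : IntegrableOn g (Ioc a b) :=
    ((hθi.const_mul (2 * l)).sub (by simp)).const_mul c
  have hgint : ∫ x in Ioc a b, g x = c * (θ b - θ a) ^ 2 / (b - a) := by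
    rw [← intervalIntegral.integral_of_le hab.le, hg, intervalIntegral.integral_const_mul,
      intervalIntegral.integral_sub (hac.intervalIntegrable_deriv.const_mul _) (by simp),
      intervalIntegral.integral_const_mul, hac.integral_deriv_eq_sub,
      intervalIntegral.integral_const, hl, smul_eq_mul]
    field_simp
    ring
  have hsub : Ioc a b ⊆ I := Ioc_subset_Icc_self.trans (hI.ordConnected.out ha hb)
  have hind : IntegrableOn ((Ioc a b).indicator g) I :=
    (hgi.integrable_indicator measurableSet_Ioc).integrableOn
  have hindint : ∫ x in I, (Ioc a b).indicator g x = ∫ x in Ioc a b, g x := by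
    rw [setIntegral_indicator measurableSet_Ioc, inter_eq_right.2 hsub]
  have hs : IntegrableOn (fun x => deriv u x ^ 2 + deriv ψ x ^ 2) I :=
    hu.integrableOn_deriv_sq.add hψ.integrableOn_deriv_sq
  rw [← hgint, ← hindint, ← integral_add hu.integrableOn_deriv_sq hψ.integrableOn_deriv_sq,
    ← integral_sub hs hind]
  refine integral_mono_ae (hu.sqrt_sq_add_sq hI hψ hψ1 hpos).integrableOn_deriv_sq
    (hs.sub hind) ?_
  filter_upwards [hu.ae_deriv_sqrt_sq_add_sq_sq hI (hψ1.differentiable one_ne_zero) hpos] with x hx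
  rw [hx]
  refine sub_le_sub_left ?_ _
  by_cases hxJ : x ∈ Ioc a b
  · rw [indicator_of_mem hxJ]
    have h1 : c ≤ u x ^ 2 + ψ x ^ 2 := by
      have := hcψ x (Ioc_subset_Icc_self hxJ)
      nlinarith [sq_nonneg (u x)]
    have h2 : 2 * l * deriv θ x - l ^ 2 ≤ deriv θ x ^ 2 := by nlinarith [sq_nonneg (deriv θ x - l)]
    calc c * (2 * l * deriv θ x - l ^ 2) ≤ c * deriv θ x ^ 2 := by gcongr
      _ ≤ _ := by gcongr
  · rw [indicator_of_notMem hxJ]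
    positivity

end Perturbation

theorem half_le_arctan_sq {y : ℝ} (hy : 1 ≤ |y|) : 1 / 2 ≤ Real.arctan y ^ 2 := by
  have h1 : Real.pi / 4 ≤ |Real.arctan y| := by
    rcases le_abs.1 hy with h | h
    · rw [← Real.arctan_one]
      exact (Real.arctan_strictMono.monotone h).trans (le_abs_self _)
    · rw [← Real.arctan_one, ← abs_neg, ← Real.arctan_neg]
      exact (Real.arctan_strictMono.monotone h).trans (le_abs_self _)
  have h2 := Real.pi_gt_three
  rw [← sq_abs]
  nlinarith

variable {V B H : Type*} {G : MetricGraph V B H} {u : B ⊕ H → ℝ → ℝ}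

/-- On a connected graph, a function which vanishes at some point but not everywhere does so on
some edge. -/
theorem MemH1.exists_edge_of_zero (hconn : G.IsConnected) (hu : G.MemH1 u)
    (hz : ∃ e, ∃ x ∈ G.interval e, u e x = 0) (hn : ∃ e, ∃ x ∈ G.interval e, u e x ≠ 0) :
    ∃ e, ∃ x ∈ G.interval e, ∃ y ∈ G.interval e, u e x = 0 ∧ u e y ≠ 0 := by
  by_contra! hcon
  obtain ⟨φ, hφ⟩ := hu.2
  have hend : ∀ e, ∃ x ∈ G.interval e, ∃ v, G.AtVertex e x v := by
    rintro (b | h)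
    · exact ⟨0, ⟨le_rfl, (G.len_pos b).le⟩, _, .src b⟩
    · exact ⟨0, self_mem_Ici, _, .root h⟩
  have hadj : ∀ b, φ (G.src b) = 0 ↔ φ (G.tgt b) = 0 := fun b => by
    rw [← hφ _ _ _ (.src b), ← hφ _ _ _ (.tgt b)]
    have h0 : (0 : ℝ) ∈ G.interval (.inl b) := ⟨le_rfl, (G.len_pos b).le⟩
    have hl : G.len b ∈ G.interval (.inl b) := ⟨(G.len_pos b).le, le_rfl⟩
    exact ⟨hcon _ _ h0 _ hl, hcon _ _ hl _ h0⟩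
  obtain ⟨e, x, hx, hux⟩ := hz
  obtain ⟨x', hx', v, hv⟩ := hend e
  have hφv : φ v = 0 := by
    rw [← hφ _ _ _ hv]
    exact hcon e x hx x' hx' hux
  have hall : ∀ w, φ w = 0 := fun w => by
    have hr := (SimpleGraph.reachable_iff_reflTransGen v w).1 (hconn.preconnected v w)
    induction hr with
    | refl => exact hφv
    | tail _ hbc ih =>
      rw [SimpleGraph.fromRel_adj] at hbc
      rcases hbc.2 with ⟨b, rfl, rfl⟩ | ⟨b, rfl, rfl⟩
      · exact (hadj b).1 ih
      · exact (hadj b).2 ih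
  obtain ⟨e', y, hy, hne⟩ := hn
  obtain ⟨x'', hx'', v', hv'⟩ := hend e'
  exact hne (hcon e' x'' hx'' y hy ((hφ _ _ _ hv').trans (hall v')))

/-- A positive function in `H¹(G)`. -/
noncomputable def profile : B ⊕ H → ℝ → ℝ := Sum.elim (fun _ _ => 1) fun _ => soliton 1 0

theorem profile_pos (e : B ⊕ H) (x : ℝ) : 0 < profile e x := by
  cases e with
  | inl b => exact one_pos
  | inr h => exact Real.sqrt_pos.2 (div_pos one_pos (Real.cosh_pos _))

theorem contDiff_profile (e : B ⊕ H) : ContDiff ℝ 1 (profile e) := by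
  cases e with
  | inl b => exact contDiff_const
  | inr h => exact contDiff_soliton one_pos 0

theorem memH1_profile (G : MetricGraph V B H) : G.MemH1 (profile : B ⊕ H → ℝ → ℝ) := by
  refine ⟨?_, fun _ => 1, ?_⟩
  · rintro (b | h)
    · exact memH1Interval_const _ _
    · exact memH1Interval_soliton one_pos 0
  · rintro _ _ _ (b | b | h)
    · rfl
    · rfl
    · simp [profile, soliton]

variable [Fintype B] [Fintype H]

/-- If `u` vanishes at some but not all points of an edge, adding a small positive function to `u`
in polar coordinates decreases the kinetic energy at an arbitrarily large rate. -/
theorem MemH1.exists_perturbation (hu : G.MemH1 u) {e : B ⊕ H} {z y : ℝ} (hz : z ∈ G.interval e)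
    (hy : y ∈ G.interval e) (hz0 : u e z = 0) (hy0 : u e y ≠ 0) {A : ℝ} (hA : 0 < A) :
    ∃ (ε : ℝ) (w : B ⊕ H → ℝ → ℝ), 0 < ε ∧ ε ≤ 1 ∧ G.MemH1 w ∧
      G.integralPow 2 w = G.integralPow 2 u +
        ε ^ 2 * G.integralPow 2 (profile : B ⊕ H → ℝ → ℝ) ∧
      G.kinetic w ≤ G.kinetic u - ε ^ 2 * A ∧ G.integralPow 6 u ≤ G.integralPow 6 w := by
  classical
  have hI := fun e => G.isEdgeInterval_interval e
  have hsub : uIcc z y ⊆ G.interval e := (hI e).ordConnected.uIcc_subset hz hy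
  obtain ⟨x₀, -, hmin⟩ := (isCompact_uIcc (a := z) (b := y)).exists_isMinOn nonempty_uIcc
    ((contDiff_profile e).continuous.pow 2).continuousOn
  obtain ⟨c, hcpos, hc⟩ : ∃ c : ℝ, 0 < c ∧ ∀ x ∈ uIcc z y, c ≤ profile e x ^ 2 :=
    ⟨profile e x₀ ^ 2, pow_pos (profile_pos _ _) 2, fun x hx => hmin hx⟩
  obtain ⟨C₁, hC₁⟩ : ∃ C, C = G.kinetic (profile : B ⊕ H → ℝ → ℝ) := ⟨_, rfl⟩
  have hC₁0 : 0 ≤ C₁ := hC₁ ▸ G.kinetic_nonneg _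
  -- On an interval of length at most `t` the saving is at least `ε^2 c / (2t) = ε^2 (C₁ + A)`; the
  -- part `ε^2 C₁` pays for the kinetic energy of the added function.
  obtain ⟨t, ht⟩ : ∃ t, t = c / (2 * (C₁ + A)) := ⟨_, rfl⟩
  have ht0 : 0 < t := by
    rw [ht]
    positivity
  obtain ⟨a, ha, b, hb, hab, hbat, hab0⟩ := exists_short_step hz0 hy0 ht0
  -- The angle is `0` at the endpoint where `u` vanishes. At the other one, a small `ε` makes it at
  -- least `π / 4` in absolute value, and `(π / 4)^2 > 1 / 2`.
  obtain ⟨ε, hε0, hε1, hθ⟩ : ∃ ε : ℝ, 0 < ε ∧ ε ≤ 1 ∧ 1 / 2 ≤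
      (Real.arctan (u e b / (ε * profile e b)) - Real.arctan (u e a / (ε * profile e a))) ^ 2 := by
    have key : ∀ s : ℝ, u e s ≠ 0 → ∃ ε : ℝ, 0 < ε ∧ ε ≤ 1 ∧ 1 ≤ |u e s / (ε * profile e s)| := by
      intro s hs
      have hp := profile_pos e s
      have hs' : 0 < |u e s| := abs_pos.2 hs
      have hmin0 : 0 < min 1 (|u e s| / profile e s) := lt_min one_pos (by positivity)
      refine ⟨min 1 (|u e s| / profile e s), hmin0, min_le_left _ _, ?_⟩
      rw [abs_div, abs_of_pos (mul_pos hmin0 hp), one_le_div (mul_pos hmin0 hp), ← le_div_iff₀ hp]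
      exact min_le_right _ _
    rcases hab0 with ⟨h1, h2⟩ | ⟨h1, h2⟩
    · obtain ⟨ε, h3, h4, h5⟩ := key b h2
      refine ⟨ε, h3, h4, ?_⟩
      rw [h1, zero_div, Real.arctan_zero, sub_zero]
      exact half_le_arctan_sq h5
    · obtain ⟨ε, h3, h4, h5⟩ := key a h1
      refine ⟨ε, h3, h4, ?_⟩
      rw [h2, zero_div, Real.arctan_zero, zero_sub, neg_sq]
      exact half_le_arctan_sq h5
  let ψ : B ⊕ H → ℝ → ℝ := fun e x => ε * profile e x
  have hψH : G.MemH1 ψ := (memH1_profile G).const_mul ε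
  have hψ1 : ∀ e, ContDiff ℝ 1 (ψ e) := fun e => contDiff_const.mul (contDiff_profile e)
  have hψpos : ∀ e x, 0 < ψ e x := fun e x => mul_pos hε0 (profile_pos e x)
  let w : B ⊕ H → ℝ → ℝ := fun e x => √(u e x ^ 2 + ψ e x ^ 2)
  have hwH : G.MemH1 w := by
    obtain ⟨φ₁, hφ₁⟩ := hu.2
    obtain ⟨φ₂, hφ₂⟩ := hψH.2
    refine ⟨fun e => (hu.1 e).sqrt_sq_add_sq (hI e) (hψH.1 e) (hψ1 e) (hψpos e),
      fun v => √(φ₁ v ^ 2 + φ₂ v ^ 2), fun e x v h => ?_⟩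
    change √(u e x ^ 2 + ψ e x ^ 2) = √(φ₁ v ^ 2 + φ₂ v ^ 2)
    rw [hφ₁ e x v h, hφ₂ e x v h]
  refine ⟨ε, w, hε0, hε1, hwH, ?_, ?_, ?_⟩
  · rw [← integralPow_two_const_mul, integralPow_two_eq, integralPow_two_eq,
      integralPow_two_eq, ← Finset.sum_add_distrib]
    exact Finset.sum_congr rfl fun e _ => (hu.1 e).integral_sqrt_sq_add_sq_sq (hψH.1 e)
  · have hJ : Icc a b ⊆ uIcc z y := ordConnected_uIcc.out ha hb
    have h1 := (hu.1 e).integral_deriv_sqrt_sq_add_sq_le_sub (hI e) (hψH.1 e) (hψ1 e) (hψpos e)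
      (hsub ha) (hsub hb) hab (c := ε ^ 2 * c) (by positivity) fun x hx => by
        have := hc x (hJ hx)
        change ε ^ 2 * c ≤ (ε * profile e x) ^ 2
        rw [mul_pow]
        gcongr
    have h2 : ε ^ 2 * (C₁ + A) ≤ ε ^ 2 * c * (Real.arctan (u e b / ψ e b) -
        Real.arctan (u e a / ψ e a)) ^ 2 / (b - a) := by
      rw [le_div_iff₀ (sub_pos.2 hab)]
      calc ε ^ 2 * (C₁ + A) * (b - a) ≤ ε ^ 2 * (C₁ + A) * t := by gcongr
        _ = ε ^ 2 * c * (1 / 2) := by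
          rw [ht]
          field_simp
        _ ≤ _ := by gcongr
    have h3 : ∑ e' ∈ Finset.univ.erase e, ∫ x in G.interval e', deriv (w e') x ^ 2 ≤
        ∑ e' ∈ Finset.univ.erase e, ((∫ x in G.interval e', deriv (u e') x ^ 2) +
          ∫ x in G.interval e', deriv (ψ e') x ^ 2) :=
      Finset.sum_le_sum fun e' _ => (hu.1 e').integral_deriv_sqrt_sq_add_sq_le (hI e') (hψH.1 e')
        (hψ1 e') (hψpos e')
    have h4 : G.kinetic u + ε ^ 2 * C₁ = ∑ e', ((∫ x in G.interval e', deriv (u e') x ^ 2) +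
          ∫ x in G.interval e', deriv (ψ e') x ^ 2) := by
      rw [hC₁, ← kinetic_const_mul, kinetic_eq, kinetic_eq, ← Finset.sum_add_distrib]
    have h5 : G.kinetic w ≤ G.kinetic u + ε ^ 2 * C₁ - ε ^ 2 * (C₁ + A) := by
      rw [h4, kinetic_eq, ← Finset.add_sum_erase _ _ (Finset.mem_univ e),
        ← Finset.add_sum_erase _ _ (Finset.mem_univ e)]
      linarith
    linarith
  · rw [integralPow_six_eq, integralPow_six_eq]
    refine Finset.sum_le_sum fun e _ => integral_mono ((hu.1 e).integrableOn_pow_six (hI e))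
      ((hwH.1 e).integrableOn_pow_six (hI e)) fun x => ?_
    have h1 : w e x ^ 2 = u e x ^ 2 + ψ e x ^ 2 := Real.sq_sqrt (by positivity)
    calc u e x ^ 6 = (u e x ^ 2) ^ 3 := by ring
      _ ≤ (w e x ^ 2) ^ 3 := by
        rw [h1]
        gcongr
        exact le_add_of_nonneg_right (sq_nonneg _)
      _ = w e x ^ 6 := by ring

/-- Extremal functions of the Gagliardo-Nirenberg inequality do not vanish anywhere. -/
theorem MemH1.ne_zero_of_extremal (hconn : G.IsConnected) (hu : G.MemH1 u) {K : ℝ}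
    (hK0 : 0 ≤ K) (hK : ∀ w : B ⊕ H → ℝ → ℝ, G.MemH1 w →
      G.integralPow 6 w ≤ K * G.integralPow 2 w ^ 2 * G.kinetic w)
    (hext : G.integralPow 6 u = K * G.integralPow 2 u ^ 2 * G.kinetic u)
    (hpos : 0 < G.integralPow 6 u) : ∀ e, ∀ x ∈ G.interval e, u e x ≠ 0 := by
  by_contra! hzero
  have hn : ∃ e, ∃ x ∈ G.interval e, u e x ≠ 0 := by
    by_contra! h0
    have : G.integralPow 6 u = 0 := by
      rw [integralPow_six_eq]
      refine Finset.sum_eq_zero fun e _ => ?_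
      rw [setIntegral_congr_fun (g := fun _ => (0 : ℝ)) (G.isEdgeInterval_interval e).measurableSet
        fun x hx => by simp [h0 e x hx]]
      simp
    linarith
  obtain ⟨e, z, hz, y, hy, hz0, hy0⟩ := hu.exists_edge_of_zero hconn hzero hn
  obtain ⟨m, hm⟩ : ∃ m, m = G.integralPow 2 u := ⟨_, rfl⟩
  obtain ⟨k, hk⟩ : ∃ k, k = G.kinetic u := ⟨_, rfl⟩
  obtain ⟨C₂, hC₂⟩ : ∃ C, C = G.integralPow 2 (profile : B ⊕ H → ℝ → ℝ) := ⟨_, rfl⟩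
  have hC₂0 : 0 ≤ C₂ := hC₂ ▸ G.integralPow_nonneg 2 _
  have hm0 : 0 ≤ m := hm ▸ G.integralPow_nonneg 2 u
  have hk0 : 0 ≤ k := hk ▸ G.kinetic_nonneg u
  rw [← hm, ← hk] at hext
  have hKpos : 0 < K := lt_of_le_of_ne hK0 fun h => by rw [hext, ← h] at hpos; simp at hpos
  have hmpos : 0 < m := lt_of_le_of_ne hm0 fun h => by rw [hext, ← h] at hpos; simp at hpos
  -- For `ε ≤ 1` the squared mass grows by at most `ε^2 C₃`. The rate `A` below satisfies `A m^2 =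
  -- C₃ k + 1`, so the right-hand side of the inequality drops by at least `K ε^2`, contradicting
  -- extremality.
  obtain ⟨C₃, hC₃⟩ : ∃ C, C = 2 * m * C₂ + C₂ ^ 2 := ⟨_, rfl⟩
  have hC₃0 : 0 ≤ C₃ := by
    rw [hC₃]
    positivity
  obtain ⟨A, hA⟩ : ∃ A, A = (C₃ * k + 1) / m ^ 2 := ⟨_, rfl⟩
  have hA0 : 0 < A := by
    rw [hA]
    positivity
  have hAm : A * m ^ 2 = C₃ * k + 1 := by
    rw [hA]
    field_simp
  obtain ⟨ε, w, hε0, hε1, hw, hmw, hkw, hpw⟩ := hu.exists_perturbation hz hy hz0 hy0 hA0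
  rw [← hm, ← hC₂] at hmw
  rw [← hk] at hkw
  have hgn := hpw.trans (hK w hw)
  rw [hext, hmw, mul_assoc, mul_assoc] at hgn
  have hgn' := le_of_mul_le_mul_left hgn hKpos
  have hε2 : ε ^ 2 ≤ 1 := pow_le_one₀ hε0.le hε1
  have hsq : (m + ε ^ 2 * C₂) ^ 2 ≤ m ^ 2 + ε ^ 2 * C₃ := by
    have : ε ^ 2 * ε ^ 2 * C₂ ^ 2 ≤ ε ^ 2 * 1 * C₂ ^ 2 := by gcongr
    rw [hC₃]
    linarith
  have hfin : m ^ 2 * k ≤ (m ^ 2 + ε ^ 2 * C₃) * (k - ε ^ 2 * A) :=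
    hgn'.trans (mul_le_mul hsq hkw (G.kinetic_nonneg w) (by positivity))
  have hε4 : 0 ≤ ε ^ 2 * C₃ * (ε ^ 2 * A) := by positivity
  have hεpos : 0 < ε ^ 2 := by positivity
  have hAm' : ε ^ 2 * (A * m ^ 2) = ε ^ 2 * (C₃ * k + 1) := by rw [hAm]
  linarith

end MetricGraph

namespace MetricGraph

variable {V B H : Type*} {G : MetricGraph V B H}

/-! ### Reduction to real functions -/

section Reduction

variable {𝕜 : Type*} [RCLike 𝕜]

theorem MemH1.norm {u : B ⊕ H → ℝ → 𝕜} (hu : G.MemH1 u) :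
    G.MemH1 fun e x => ‖u e x‖ := by
  obtain ⟨φ, hφ⟩ := hu.2
  exact ⟨fun e => (hu.1 e).norm (G.isEdgeInterval_interval e), fun v => ‖φ v‖, fun e x v h =>
    congrArg _ (hφ e x v h)⟩

theorem norm_deriv_ofReal_comp (f : ℝ → ℝ) (x : ℝ) :
    ‖deriv (fun x => (f x : 𝕜)) x‖ = ‖deriv f x‖ := by
  by_cases h : DifferentiableAt ℝ f x
  · have h1 : HasDerivAt (fun x => (f x : 𝕜)) ((deriv f x : ℝ) : 𝕜) x :=
      (RCLike.ofRealCLM (K := 𝕜)).hasFDerivAt.comp_hasDerivAt x h.hasDerivAt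
    rw [h1.deriv, RCLike.norm_ofReal, Real.norm_eq_abs]
  -- Taking real parts recovers `f`, so both functions fail to be differentiable together, and both
  -- derivatives have the default value `0`.
  · have h1 : ¬ DifferentiableAt ℝ (fun x => (f x : 𝕜)) x := fun h' => h <| by
      have := (RCLike.reCLM (K := 𝕜)).differentiableAt.comp x h'
      simpa [Function.comp_def] using this
    rw [deriv_zero_of_not_differentiableAt h, deriv_zero_of_not_differentiableAt h1]
    simp

theorem MemH1Interval.ofReal {I : Set ℝ} {f : ℝ → ℝ} (hf : MemH1Interval I f) :
    MemH1Interval I fun x => (f x : 𝕜) := by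
  refine ⟨fun a ha b hb => ?_, hf.2.1.ofReal, ?_⟩
  · exact (hf.1 a ha b hb).lipschitz_comp (g := fun y : ℝ => (y : 𝕜)) (C := 1) fun x _ y _ => by
      rw [one_mul, dist_eq_norm, dist_eq_norm, ← RCLike.ofReal_sub, RCLike.norm_ofReal,
        Real.norm_eq_abs]
  · exact hf.2.2.mono (measurable_deriv _).aestronglyMeasurable
      (.of_forall fun x => (norm_deriv_ofReal_comp f x).le)

theorem MemH1.ofReal {u : B ⊕ H → ℝ → ℝ} (hu : G.MemH1 u) :
    G.MemH1 fun e x => (u e x : 𝕜) := by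
  obtain ⟨φ, hφ⟩ := hu.2
  exact ⟨fun e => (hu.1 e).ofReal, fun v => (φ v : 𝕜), fun e x v h =>
    congrArg _ (hφ e x v h)⟩

variable [Fintype B] [Fintype H]

theorem integralPow_norm (G : MetricGraph V B H) (p : ℕ) (u : B ⊕ H → ℝ → 𝕜) :
    G.integralPow p (fun e x => ‖u e x‖) = G.integralPow p u := by
  simp [integralPow]

theorem MemH1.kinetic_norm_le {u : B ⊕ H → ℝ → 𝕜} (hu : G.MemH1 u) :
    G.kinetic (fun e x => ‖u e x‖) ≤ G.kinetic u := by
  refine Finset.sum_le_sum fun e _ => ?_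
  have hI := G.isEdgeInterval_interval e
  refine integral_mono_ae ((hu.1 e).norm hI).integrableOn_norm_deriv_sq
    (hu.1 e).integrableOn_norm_deriv_sq ?_
  filter_upwards [(hu.1 e).ae_abs_deriv_norm_le hI] with x hx
  gcongr
  exact hx

theorem integralPow_ofReal (G : MetricGraph V B H) (p : ℕ) (u : B ⊕ H → ℝ → ℝ) :
    G.integralPow p (fun e x => (u e x : 𝕜)) = G.integralPow p u := by
  simp [integralPow]

theorem kinetic_ofReal (G : MetricGraph V B H) (u : B ⊕ H → ℝ → ℝ) :
    G.kinetic (fun e x => (u e x : 𝕜)) = G.kinetic u := by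
  simp only [kinetic, norm_deriv_ofReal_comp]

variable (𝕜) in
-- Real functions embed into `𝕜`-valued ones; conversely the modulus keeps the Lebesgue norms and
-- does not increase the kinetic energy.
theorem gagliardoNirenbergConst_eq_real (G : MetricGraph V B H) :
    G.gagliardoNirenbergConst 𝕜 = G.gagliardoNirenbergConst ℝ := by
  unfold gagliardoNirenbergConst
  congr 1
  ext K
  refine and_congr_right fun hK => ⟨fun h u hu => ?_, fun h u hu => ?_⟩
  · have := h _ (hu.ofReal (𝕜 := 𝕜))
    rwa [integralPow_ofReal, integralPow_ofReal, kinetic_ofReal] at this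
  · have := h _ hu.norm
    rw [integralPow_norm, integralPow_norm] at this
    refine this.trans (mul_le_mul_of_nonneg_left hu.kinetic_norm_le ?_)
    positivity

variable (𝕜) in
theorem criticalMass_eq_real (G : MetricGraph V B H) :
    G.criticalMass 𝕜 = G.criticalMass ℝ := by
  rw [criticalMass, gagliardoNirenbergConst_eq_real, criticalMass]

theorem GroundStateAchieved.exists_real {μ : ℝ} (h : G.GroundStateAchieved 𝕜 μ) :
    ∃ u : B ⊕ H → ℝ → ℝ, G.MemH1 u ∧ G.integralPow 2 u = μ ∧
      ∀ w : B ⊕ H → ℝ → ℝ, G.MemH1 w → G.integralPow 2 w = μ → G.energy u ≤ G.energy w := by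
  obtain ⟨u, ⟨hu, hm⟩, hE⟩ := h
  refine ⟨_, hu.norm, by rw [integralPow_norm, hm], fun w hw hwm => ?_⟩
  have h1 : (G.energy u : EReal) ≤ G.energy fun e x => (w e x : 𝕜) := by
    rw [hE]
    exact iInf₂_le _ ⟨hw.ofReal, by rw [integralPow_ofReal, hwm]⟩
  have h2 := EReal.coe_le_coe_iff.1 h1
  have h3 := hu.kinetic_norm_le
  unfold energy at *
  rw [integralPow_ofReal, kinetic_ofReal] at h2
  rw [integralPow_norm]
  linarith

end Reduction

/-! ### Removal of a half-line -/

theorem setIntegral_pos_of_ne_zero {e : B ⊕ H} {f : ℝ → ℝ} (hf : IntegrableOn f (G.interval e))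
    (hnn : ∀ x, 0 ≤ f x) (hne : ∀ x ∈ G.interval e, f x ≠ 0) : 0 < ∫ x in G.interval e, f x := by
  rw [setIntegral_pos_iff_support_of_nonneg_ae (.of_forall hnn) hf,
    inter_eq_right.2 fun x hx => Function.mem_support.2 (hne x hx)]
  exact pos_iff_ne_zero.2 (G.volume_interval_ne_zero e)

/-- The restriction of a function to the graph obtained by removing a half-line. -/
def restrictRemove (l : H) (u : B ⊕ H → ℝ → ℝ) : B ⊕ {h : H // h ≠ l} → ℝ → ℝ :=
  fun e => u (e.map id Subtype.val)

theorem MemH1.memH1_restrictRemove {u : B ⊕ H → ℝ → ℝ} (hu : G.MemH1 u) (l : H) :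
    (G.removeHalfLine l).MemH1 (restrictRemove l u) := by
  obtain ⟨φ, hφ⟩ := hu.2
  refine ⟨?_, φ, ?_⟩
  · rintro (b | h)
    · exact hu.1 (.inl b)
    · exact hu.1 (.inr h)
  · rintro _ _ _ (b | b | h)
    · exact hφ _ _ _ (.src b)
    · exact hφ _ _ _ (.tgt b)
    · exact hφ _ _ _ (.root h.1)

theorem interval_removeHalfLine (G : MetricGraph V B H) (l : H) (e : B ⊕ {h : H // h ≠ l}) :
    (G.removeHalfLine l).interval e = G.interval (e.map id Subtype.val) := by
  cases e <;> rfl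

/-! ### The Gagliardo-Nirenberg constant -/

variable [Fintype B] [Fintype H]

theorem bddBelow_gagliardoNirenberg (G : MetricGraph V B H) :
    BddBelow {K : ℝ | 0 ≤ K ∧ ∀ u : B ⊕ H → ℝ → ℝ, G.MemH1 u →
      G.integralPow 6 u ≤ K * G.integralPow 2 u ^ 2 * G.kinetic u} :=
  ⟨0, fun _ hK => hK.1⟩

/-- The set of admissible constants is nonempty, so its infimum is not the default value `0`. -/
theorem mem_gagliardoNirenberg (hconn : G.IsConnected) (hH : Nonempty H) :
    3 / halfLineMass ^ 2 ∈ {K : ℝ | 0 ≤ K ∧ ∀ u : B ⊕ H → ℝ → ℝ, G.MemH1 u →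
      G.integralPow 6 u ≤ K * G.integralPow 2 u ^ 2 * G.kinetic u} :=
  ⟨by positivity, fun _ hu => hu.gagliardoNirenberg_halfLine hconn hH⟩

/-- The infimum is itself admissible: divide by the product of mass and kinetic terms when it is
positive. When it is zero, the inequality with the half-line constant already gives the claim. -/
theorem MemH1.gagliardoNirenberg (hconn : G.IsConnected) (hH : Nonempty H)
    {u : B ⊕ H → ℝ → ℝ} (hu : G.MemH1 u) : G.integralPow 6 u ≤
      G.gagliardoNirenbergConst ℝ * G.integralPow 2 u ^ 2 * G.kinetic u := by
  have hX : 0 ≤ G.integralPow 2 u ^ 2 * G.kinetic u :=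
    mul_nonneg (sq_nonneg _) (G.kinetic_nonneg u)
  rw [mul_assoc]
  rcases hX.eq_or_lt with h0 | hpos
  · have := hu.gagliardoNirenberg_halfLine hconn hH
    rw [mul_assoc, ← h0, mul_zero] at this
    rwa [← h0, mul_zero]
  · rw [← div_le_iff₀ hpos]
    refine le_csInf ⟨_, mem_gagliardoNirenberg hconn hH⟩ fun K hK => ?_
    rw [div_le_iff₀ hpos, ← mul_assoc]
    exact hK.2 u hu

theorem le_gagliardoNirenbergConst (hconn : G.IsConnected) (hH : Nonempty H) :
    3 / (2 * halfLineMass) ^ 2 ≤ G.gagliardoNirenbergConst ℝ :=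
  le_of_gagliardoNirenberg hH fun _ hu => hu.gagliardoNirenberg hconn hH

theorem gagliardoNirenbergConst_pos (hconn : G.IsConnected) (hH : Nonempty H) :
    0 < G.gagliardoNirenbergConst ℝ := by
  have := halfLineMass_pos
  exact lt_of_lt_of_le (by positivity) (le_gagliardoNirenbergConst hconn hH)

theorem criticalMass_sq (hconn : G.IsConnected) (hH : Nonempty H) :
    G.criticalMass ℝ ^ 2 = 3 / G.gagliardoNirenbergConst ℝ :=
  Real.sq_sqrt (div_nonneg (by norm_num) (gagliardoNirenbergConst_pos hconn hH).le)

theorem criticalMass_pos (hconn : G.IsConnected) (hH : Nonempty H) : 0 < G.criticalMass ℝ :=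
  Real.sqrt_pos.2 (div_pos (by norm_num) (gagliardoNirenbergConst_pos hconn hH))

theorem criticalMass_le (hconn : G.IsConnected) (hH : Nonempty H) :
    G.criticalMass ℝ ≤ 2 * halfLineMass := by
  have h0 := halfLineMass_pos
  have h1 := le_gagliardoNirenbergConst hconn hH
  rw [criticalMass, Real.sqrt_le_left (by positivity),
    div_le_iff₀ (gagliardoNirenbergConst_pos hconn hH), mul_comm]
  exact (div_le_iff₀ (by positivity)).1 h1

theorem criticalMass_eq_halfLineMass (hconn : G.IsConnected) (hH : Fintype.card H = 1) :
    G.criticalMass ℝ = halfLineMass := by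
  have hH' : Nonempty H := Fintype.card_pos_iff.1 (by omega)
  have h1 : G.gagliardoNirenbergConst ℝ = 3 / halfLineMass ^ 2 :=
    le_antisymm (csInf_le G.bddBelow_gagliardoNirenberg (mem_gagliardoNirenberg hconn hH'))
      (le_of_gagliardoNirenberg_of_card_eq_one hH fun _ hu => hu.gagliardoNirenberg hconn hH')
  rw [criticalMass, h1, div_div_cancel₀ (by norm_num), Real.sqrt_sq halfLineMass_pos.le]

theorem MemH1.integralPow_six_pos {u : B ⊕ H → ℝ → ℝ} (hu : G.MemH1 u)
    (hm : 0 < G.integralPow 2 u) : 0 < G.integralPow 6 u := by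
  refine lt_of_le_of_ne (G.integralPow_nonneg 6 u) fun h0 => hm.ne' ?_
  rw [integralPow_six_eq] at h0
  have hnn : ∀ x : ℝ, 0 ≤ x ^ 6 := fun x => Even.pow_nonneg (by decide) x
  have h1 := (Finset.sum_eq_zero_iff_of_nonneg fun e _ => integral_nonneg fun x =>
    hnn (u e x)).1 h0.symm
  rw [integralPow_two_eq]
  refine Finset.sum_eq_zero fun e he => ?_
  have h2 := (integral_eq_zero_iff_of_nonneg (fun x => hnn (u e x))
    ((hu.1 e).integrableOn_pow_six (G.isEdgeInterval_interval e))).1 (h1 e he)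
  refine integral_eq_zero_of_ae (h2.mono fun x hx => ?_)
  have : u e x = 0 := pow_eq_zero_iff (by norm_num) |>.1 hx
  simp [this]

/-! ### Ground states -/

variable [DecidableEq H]

theorem sum_removeHalfLine (l : H) (f : B ⊕ H → ℝ) :
    ∑ e, f e = f (.inr l) + ∑ e : B ⊕ {h : H // h ≠ l}, f (e.map id Subtype.val) := by
  rw [Fintype.sum_sum_type, Fintype.sum_sum_type,
    Fintype.sum_eq_add_sum_subtype_ne (fun h => f (.inr h)) l]
  simp only [Sum.map_inl, Sum.map_inr, id]
  ring

theorem integralPow_two_restrictRemove (l : H) (u : B ⊕ H → ℝ → ℝ) :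
    G.integralPow 2 u = (∫ x in Ici 0, u (.inr l) x ^ 2) +
      (G.removeHalfLine l).integralPow 2 (restrictRemove l u) := by
  rw [integralPow_two_eq, integralPow_two_eq, sum_removeHalfLine l]
  simp only [interval_removeHalfLine]
  rfl

theorem integralPow_six_restrictRemove (l : H) (u : B ⊕ H → ℝ → ℝ) :
    G.integralPow 6 u = (∫ x in Ici 0, u (.inr l) x ^ 6) +
      (G.removeHalfLine l).integralPow 6 (restrictRemove l u) := by
  rw [integralPow_six_eq, integralPow_six_eq, sum_removeHalfLine l]
  simp only [interval_removeHalfLine]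
  rfl

theorem kinetic_restrictRemove (l : H) (u : B ⊕ H → ℝ → ℝ) :
    G.kinetic u = (∫ x in Ici 0, deriv (u (.inr l)) x ^ 2) +
      (G.removeHalfLine l).kinetic (restrictRemove l u) := by
  rw [kinetic_eq, kinetic_eq, sum_removeHalfLine l]
  simp only [interval_removeHalfLine]
  rfl

/-- If a nowhere vanishing function of energy at most zero and mass at most `μ` has nonnegative
energy on a half-line, then the critical mass decreases below `μ` when this half-line is
removed. -/
theorem MemH1.criticalMass_removeHalfLine_lt (hconn : G.IsConnected) {u : B ⊕ H → ℝ → ℝ}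
    (hu : G.MemH1 u) (hne : ∀ e, ∀ x ∈ G.interval e, u e x ≠ 0)
    (hE : 3 * G.kinetic u ≤ G.integralPow 6 u) {l l' : H} (hl' : l' ≠ l)
    (hl : ∫ x in Ici 0, u (.inr l) x ^ 6 ≤ 3 * ∫ x in Ici 0, deriv (u (.inr l)) x ^ 2) :
    (G.removeHalfLine l).criticalMass ℝ < G.integralPow 2 u := by
  have hconn' : (G.removeHalfLine l).IsConnected := hconn
  have hH' : Nonempty {h : H // h ≠ l} := ⟨⟨l', hl'⟩⟩
  have hu' := hu.memH1_restrictRemove l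
  have hml : 0 < ∫ x in Ici 0, u (.inr l) x ^ 2 :=
    setIntegral_pos_of_ne_zero (G := G) (e := .inr l) (hu.1 _).integrableOn_sq
      (fun _ => sq_nonneg _) fun x hx => pow_ne_zero 2 (hne _ x hx)
  have hml' : 0 < ∫ x in Ici 0, u (.inr l') x ^ 2 :=
    setIntegral_pos_of_ne_zero (G := G) (e := .inr l') (hu.1 _).integrableOn_sq
      (fun _ => sq_nonneg _) fun x hx => pow_ne_zero 2 (hne _ x hx)
  have hm := G.integralPow_two_restrictRemove l u
  have hp := G.integralPow_six_restrictRemove l u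
  have hk := G.kinetic_restrictRemove l u
  set m' := (G.removeHalfLine l).integralPow 2 (restrictRemove l u) with hm'
  set p' := (G.removeHalfLine l).integralPow 6 (restrictRemove l u) with hp'
  set k' := (G.removeHalfLine l).kinetic (restrictRemove l u) with hk'
  have hm'0 : 0 < m' := by
    refine hml'.trans_le ?_
    rw [hm', integralPow_two_eq]
    exact Finset.single_le_sum (f := fun e => ∫ x in (G.removeHalfLine l).interval e,
      restrictRemove l u e x ^ 2) (fun e _ => integral_nonneg fun x => sq_nonneg _)
      (Finset.mem_univ (.inr ⟨l', hl'⟩))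
  have hp'0 : 0 < p' := hu'.integralPow_six_pos hm'0
  have hgn := hu'.gagliardoNirenberg hconn' hH'
  have hK' := gagliardoNirenbergConst_pos hconn' hH'
  set K' := (G.removeHalfLine l).gagliardoNirenbergConst ℝ with hKdef
  rw [← hm', ← hp', ← hk'] at hgn
  have hk'0 : 0 < k' := lt_of_le_of_ne (kinetic_nonneg _ _) fun h => by
    rw [← h, mul_zero] at hgn
    linarith
  -- Removing a half-line of nonnegative energy leaves `3 k' ≤ p'`, which is compared with the
  -- inequality on the smaller graph.
  have h3 : 3 ≤ K' * m' ^ 2 := by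
    have : 3 * k' ≤ K' * m' ^ 2 * k' := by linarith
    exact le_of_mul_le_mul_right this hk'0
  have h4 : (G.removeHalfLine l).criticalMass ℝ ≤ m' := by
    rw [criticalMass, Real.sqrt_le_left hm'0.le, ← hKdef, div_le_iff₀ hK', mul_comm]
    exact h3
  linarith

theorem exists_removeHalfLine_of_groundState (hconn : G.IsConnected) (hH : Nonempty H)
    (hG : ¬ G.IsometricToHalfLine) {u : B ⊕ H → ℝ → ℝ} (hu : G.MemH1 u)
    (hm : G.integralPow 2 u = G.criticalMass ℝ)
    (hmin : ∀ w : B ⊕ H → ℝ → ℝ, G.MemH1 w → G.integralPow 2 w = G.criticalMass ℝ →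
      G.energy u ≤ G.energy w) :
    ∃ l : H, (G.removeHalfLine l).IsNoncompact ∧
      (G.removeHalfLine l).criticalMass ℝ < G.criticalMass ℝ := by
  have hμ := criticalMass_pos hconn hH
  have hK := gagliardoNirenbergConst_pos hconn hH
  have hE0 : G.energy u ≤ 0 := le_of_forall_pos_le_add fun δ hδ => by
    obtain ⟨w, hw, hwm, hwE⟩ := G.exists_energy_le hH hμ hδ
    linarith [hmin w hw hwm]
  have hE : 3 * G.kinetic u ≤ G.integralPow 6 u := by
    unfold energy at hE0
    linarith
  have hgn := hu.gagliardoNirenberg hconn hH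
  have hKm : G.gagliardoNirenbergConst ℝ * G.integralPow 2 u ^ 2 = 3 := by
    rw [hm, criticalMass_sq hconn hH]
    field_simp
  -- At the critical mass the inequality reads `p ≤ 3 k`, so the energy is exactly zero and `u` is
  -- extremal.
  have hE' : 3 * G.kinetic u = G.integralPow 6 u := le_antisymm hE (by rwa [hKm] at hgn)
  have hp := hu.integralPow_six_pos (hm ▸ hμ)
  have hne := hu.ne_zero_of_extremal hconn hK.le (fun w hw => hw.gagliardoNirenberg hconn hH)
    (by rw [hKm, hE']) hp
  rcases subsingleton_or_nontrivial H with hs | hn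
  · refine absurd (hu.isometricToHalfLine hconn hH hne hE' ?_) hG
    rw [hm]
    exact criticalMass_eq_halfLineMass hconn
      (le_antisymm (Fintype.card_le_one_iff_subsingleton.2 hs) (Fintype.card_pos_iff.2 hH))
  -- Negative energy on every half-line would give two of them more than `2 * halfLineMass`
  -- together, which exceeds the critical mass.
  obtain ⟨l, hl⟩ : ∃ l : H,
      ∫ x in Ici 0, u (.inr l) x ^ 6 ≤ 3 * ∫ x in Ici 0, deriv (u (.inr l)) x ^ 2 := by
    by_contra! hcon
    have hmass := fun l => (hu.1 (.inr l)).halfLineMass_lt (hcon l)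
    obtain ⟨l₁, l₂, h12⟩ := exists_pair_ne H
    have h1 := G.integralPow_two_restrictRemove l₁ u
    have h2 : ∫ x in Ici 0, u (.inr l₂) x ^ 2 ≤
        (G.removeHalfLine l₁).integralPow 2 (restrictRemove l₁ u) := by
      rw [integralPow_two_eq]
      exact Finset.single_le_sum (f := fun e => ∫ x in (G.removeHalfLine l₁).interval e,
        restrictRemove l₁ u e x ^ 2) (fun e _ => integral_nonneg fun x => sq_nonneg _)
        (Finset.mem_univ (.inr ⟨l₂, h12.symm⟩))
    linarith [hmass l₁, hmass l₂, criticalMass_le hconn hH]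
  obtain ⟨l', hl'⟩ := exists_ne l
  refine ⟨l, ⟨⟨l', hl'⟩⟩, ?_⟩
  rw [← hm]
  exact hu.criticalMass_removeHalfLine_lt hconn hne hE hl' hl

end MetricGraph

theorem proposition2 {𝕜 : Type*} [RCLike 𝕜] {V B H : Type*}
    [Finite V] [Fintype B] [Fintype H] [DecidableEq H]
    (G : MetricGraph V B H) (hconn : G.IsConnected) (hnoncompact : G.IsNoncompact)
    (hG : ¬ G.IsometricToHalfLine)
    (hach : G.GroundStateAchieved 𝕜 (G.criticalMass 𝕜)) :
    ∃ l : H, (G.removeHalfLine l).IsNoncompact ∧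
      (G.removeHalfLine l).criticalMass 𝕜 < G.criticalMass 𝕜 := by
  rw [G.criticalMass_eq_real 𝕜] at hach ⊢
  obtain ⟨u, hu, hm, hmin⟩ := hach.exists_real
  obtain ⟨l, hl, hlt⟩ :=
    MetricGraph.exists_removeHalfLine_of_groundState hconn hnoncompact hG hu hm hmin
  exact ⟨l, hl, by rwa [(G.removeHalfLine l).criticalMass_eq_real 𝕜]⟩
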